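/- A local measure is a map $\mu$ from the bounded Borel subsets of $\mathbb{R}$ to $\mathbb{R}$ such that $\mu(\cdot\cap K)$ is a finite signed Radon measure for every compact $K\subseteq\mathbb{R}$; $|\mu|$ denotes its total variation, and $\mu$ is uniformly locally bounded if $\|\mu\|_{\mathrm{unif}}:=\sup_{t\in\mathbb{R}}|\mu|((t,t+1])<\infty$. For such $\mu$ let $H_\mu$ be the operator in the complex space $L_2(\mathbb{R})$ associated with the form $$\tau_\mu(u,v)=\int_{\mathbb{R}}u'\,\overline{v'}\,dx+\int_{\mathbb{R}}u\,\overline{v}\,d\mu,\qquad D(\tau_\mu)=W_2^1(\mathbb{R}),$$ where in the second integral $u,v$ are the continuous representatives; that is, $u\in D(H_\mu)$ and $H_\mu u=f$ if and only if $u\in W_2^1(\mathbb{R})$, $f\in L_2(\mathbb{R})$ and $\tau_\mu(u,v)=\int_{\mathbb{R}}f\,\overline{v}\,dx$ for all $v\in W_2^1(\mathbb{R})$. Theorem. Let $(\mu_n)_{n\in\mathbb{N}}$ be a sequence of uniformly locally bounded local measures with $\sup_n\|\mu_n\|_{\mathrm{unif}}<\infty$, let $\mu$ be a uniformly locally bounded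 local measure, and assume that $\mu_n\to\mu$ vaguely, i.e. $\int f\,d\mu_n\to\int f\,d\mu$ for all $f\in C_c(\mathbb{R})$. Then the operators $H_{\mu_n}$ and $H_\mu$ are self-adjoint, and $H_{\mu_n}\to H_\mu$ in the strong resolvent sense: for every $z\in\mathbb{C}\setminus\mathbb{R}$ the resolvents $(H_{\mu_n}-z)^{-1}$ and $(H_\mu-z)^{-1}$ exist as bounded operators on $L_2(\mathbb{R})$, and $(H_{\mu_n}-z)^{-1}f\to(H_\mu-z)^{-1}f$ in $L_2(\mathbb{R})$ for every $f\in L_2(\mathbb{R})$. -/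

import Mathlib

open MeasureTheory Set Filter Topology
open scoped ENNReal NNReal ContDiff ComplexConjugate
namespace MeasureSchrodinger

/-! ### Local measures -/

/-- A local measure on `ℝ`: a real-valued map on the bounded Borel sets such that `μ(· ∩ K)` is a
(finite) signed Borel measure for every compact `K`; on `ℝ` such measures are automatically Radon.
The map is extended by `0` to all other subsets of `ℝ`. -/
structure LocalMeasure where
  toFun : Set ℝ → ℝ
  toFun_eq_zero : ∀ A, ¬(Bornology.IsBounded A ∧ MeasurableSet A) → toFun A = 0
  exists_signedMeasure : ∀ K : Set ℝ, IsCompact K →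
    ∃ ν : SignedMeasure ℝ, ∀ A, MeasurableSet A → ν A = toFun (A ∩ K)

namespace LocalMeasure

/-- The signed measure `μ(· ∩ K)` for compact `K`; see `restrict_apply`. -/
noncomputable def restrict (μ : LocalMeasure) (K : Set ℝ) (hK : IsCompact K) : SignedMeasure ℝ :=
  (μ.exists_signedMeasure K hK).choose

lemma restrict_apply (μ : LocalMeasure) {K : Set ℝ} (hK : IsCompact K) {A : Set ℝ}
    (hA : MeasurableSet A) : μ.restrict K hK A = μ.toFun (A ∩ K) :=
  (μ.exists_signedMeasure K hK).choose_spec A hA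

/-- The positive part of a local measure, glued from the Jordan decompositions on the cells
`(k, k + 1]`, `k ∈ ℤ`; see `posPart_negPart_restrict`. -/
noncomputable def posPart (μ : LocalMeasure) : Measure ℝ :=
  Measure.sum fun k : ℤ => (μ.restrict (Icc (k : ℝ) (k + 1))
    isCompact_Icc).toJordanDecomposition.posPart.restrict (Ioc (k : ℝ) (k + 1))

/-- The negative part of a local measure; see `posPart_negPart_restrict`. -/
noncomputable def negPart (μ : LocalMeasure) : Measure ℝ :=
  Measure.sum fun k : ℤ => (μ.restrict (Icc (k : ℝ) (k + 1))
    isCompact_Icc).toJordanDecomposition.negPart.restrict (Ioc (k : ℝ) (k + 1))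

/-- The total variation `|μ|` of a local measure; see `variation_restrict`. -/
noncomputable def variation (μ : LocalMeasure) : Measure ℝ := μ.posPart + μ.negPart

/-- Jordan decompositions of signed measures that agree on the subsets of `B` agree on `B`. -/
lemma jordan_restrict_congr {s t : SignedMeasure ℝ} {B : Set ℝ} (hB : MeasurableSet B)
    (h : ∀ A, MeasurableSet A → A ⊆ B → s A = t A) :
    s.toJordanDecomposition.posPart.restrict B = t.toJordanDecomposition.posPart.restrict B ∧
    s.toJordanDecomposition.negPart.restrict B = t.toJordanDecomposition.negPart.restrict B := by
  have key : ∀ r : SignedMeasure ℝ,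
      (SignedMeasure.toJordanDecomposition (r.restrict B)).posPart = r.toJordanDecomposition.posPart.restrict B ∧
      (SignedMeasure.toJordanDecomposition (r.restrict B)).negPart = r.toJordanDecomposition.negPart.restrict B := by
    intro r
    let j : JordanDecomposition ℝ :=
      { posPart := r.toJordanDecomposition.posPart.restrict B
        negPart := r.toJordanDecomposition.negPart.restrict B
        posPart_finite := inferInstance
        negPart_finite := inferInstance
        mutuallySingular := (r.toJordanDecomposition.mutuallySingular.restrict B).symm.restrict B
          |>.symm }
    have : SignedMeasure.toJordanDecomposition (r.restrict B) = j := by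
      apply SignedMeasure.toJordanDecomposition_eq
      ext A hA
      conv_lhs => rw [← r.toSignedMeasure_toJordanDecomposition]
      rw [VectorMeasure.restrict_apply _ hB hA, JordanDecomposition.toSignedMeasure,
        JordanDecomposition.toSignedMeasure, Measure.toSignedMeasure_sub_apply (hA.inter hB),
        Measure.toSignedMeasure_sub_apply hA]
      simp [j, measureReal_restrict_apply hA]
    rw [this]; exact ⟨rfl, rfl⟩
  have hst : s.restrict B = t.restrict B := by
    ext A hA
    rw [VectorMeasure.restrict_apply _ hB hA, VectorMeasure.restrict_apply _ hB hA]
    exact h _ (hA.inter hB) inter_subset_right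
  rw [← (key s).1, ← (key s).2, hst]
  exact key t

/-- On a compact set `K` the measures `posPart` and `negPart` are the Jordan parts of the signed
measure `μ(· ∩ K)`. -/
lemma posPart_negPart_restrict (μ : LocalMeasure) {K : Set ℝ} (hK : IsCompact K) :
    μ.posPart.restrict K = (μ.restrict K hK).toJordanDecomposition.posPart ∧
    μ.negPart.restrict K = (μ.restrict K hK).toJordanDecomposition.negPart := by
  have hKm := hK.measurableSet
  have hC : ∀ k : ℤ, MeasurableSet (Ioc (k : ℝ) (k + 1)) := fun k => measurableSet_Ioc
  have cell : ∀ k : ℤ, _ := fun k : ℤ => jordan_restrict_congr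
    (s := μ.restrict (Icc (k : ℝ) (k + 1)) isCompact_Icc) (t := μ.restrict K hK)
    (hKm.inter (hC k)) (by
      intro A hA hAB
      rw [restrict_apply _ _ hA, restrict_apply _ _ hA,
        inter_eq_left.2 ((hAB.trans inter_subset_right).trans Ioc_subset_Icc_self),
        inter_eq_left.2 (hAB.trans inter_subset_left)])
  have zero := (μ.restrict K hK).toSignedMeasure_toJordanDecomposition
  have full : (μ.restrict K hK).toJordanDecomposition.posPart.restrict K
        = (μ.restrict K hK).toJordanDecomposition.posPart ∧
      (μ.restrict K hK).toJordanDecomposition.negPart.restrict K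
        = (μ.restrict K hK).toJordanDecomposition.negPart := by
    have h1 := jordan_restrict_congr (s := μ.restrict K hK) (t := 0) hKm.compl (by
      intro A hA hAB
      rw [restrict_apply _ _ hA, (disjoint_left.2 hAB : Disjoint A K).inter_eq,
        ← empty_inter K, ← restrict_apply μ hK MeasurableSet.empty]
      simp)
    rw [SignedMeasure.toJordanDecomposition_zero] at h1
    simp only [JordanDecomposition.zero_posPart, JordanDecomposition.zero_negPart,
      Measure.restrict_zero] at h1
    constructor
    · conv_rhs => rw [← Measure.restrict_add_restrict_compl
        (μ := (μ.restrict K hK).toJordanDecomposition.posPart) hKm, h1.1, add_zero]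
    · conv_rhs => rw [← Measure.restrict_add_restrict_compl
        (μ := (μ.restrict K hK).toJordanDecomposition.negPart) hKm, h1.2, add_zero]
  have glue : ∀ ν : Measure ℝ,
      Measure.sum (fun k : ℤ => ν.restrict (Ioc (k : ℝ) (k + 1))) = ν := fun ν => by
    rw [← Measure.restrict_iUnion (pairwise_disjoint_Ioc_intCast ℝ) hC, iUnion_Ioc_intCast,
      Measure.restrict_univ]
  constructor
  · rw [posPart, Measure.restrict_sum _ hKm]
    simp only [Measure.restrict_restrict hKm, (cell _).1]
    simp only [← Measure.restrict_restrict hKm]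
    rw [← Measure.restrict_sum _ hKm, glue, full.1]
  · rw [negPart, Measure.restrict_sum _ hKm]
    simp only [Measure.restrict_restrict hKm, (cell _).2]
    simp only [← Measure.restrict_restrict hKm]
    rw [← Measure.restrict_sum _ hKm, glue, full.2]

lemma variation_restrict (μ : LocalMeasure) {K : Set ℝ} (hK : IsCompact K) :
    μ.variation.restrict K = (μ.restrict K hK).totalVariation := by
  rw [variation, Measure.restrict_add, (μ.posPart_negPart_restrict hK).1,
    (μ.posPart_negPart_restrict hK).2, SignedMeasure.totalVariation]

/-- The integral `∫ f dμ`; it is meaningful when `f` is integrable with respect to `|μ|`. -/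
noncomputable def integral {E : Type*} [NormedAddCommGroup E] [NormedSpace ℝ E]
    (μ : LocalMeasure) (f : ℝ → E) : E := (∫ x, f x ∂μ.posPart) - ∫ x, f x ∂μ.negPart

/-- The uniform local norm `sup_t |μ|((t, t + 1])`. -/
noncomputable def unifNorm (μ : LocalMeasure) : ℝ≥0∞ := ⨆ t : ℝ, μ.variation (Ioc t (t + 1))

/-- Vague convergence: convergence of the integrals of all `f ∈ C_c(ℝ)`. -/
def VagueTendsto (μs : ℕ → LocalMeasure) (μ : LocalMeasure) : Prop :=
  ∀ f : ℝ → ℝ, Continuous f → HasCompactSupport f →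
    Tendsto (fun n => (μs n).integral f) atTop (𝓝 (μ.integral f))

end LocalMeasure

/-! ### Weak derivatives on the line -/

/-- `g` is the distributional derivative of `u` (for locally integrable `u` and `g`). Real-valued
test functions suffice by linearity. -/
def HasWeakDeriv {E : Type*} [NormedAddCommGroup E] [NormedSpace ℝ E] (u g : ℝ → E) : Prop :=
  ∀ φ : ℝ → ℝ, ContDiff ℝ ∞ φ → HasCompactSupport φ →
    ∫ x, deriv φ x • u x = -∫ x, φ x • g x

section
variable {E : Type*} [NormedAddCommGroup E] [NormedSpace ℝ E]

lemma integrable_test_smul {u : ℝ → E} (hu : LocallyIntegrable u) {φ : ℝ → ℝ}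
    (hφ : ContDiff ℝ ∞ φ) (hc : HasCompactSupport φ) :
    Integrable (fun x => φ x • u x) ∧ Integrable (fun x => deriv φ x • u x) :=
  ⟨hu.integrable_smul_left_of_hasCompactSupport hφ.continuous hc,
   hu.integrable_smul_left_of_hasCompactSupport
     ((contDiff_infty_iff_deriv.1 hφ).2.continuous) hc.deriv⟩

lemma HasWeakDeriv.congr {u g u' g' : ℝ → E} (h : HasWeakDeriv u g)
    (hu : u =ᵐ[volume] u') (hg : g =ᵐ[volume] g') : HasWeakDeriv u' g' := by
  intro φ hφ hc
  have h1 : ∫ x, deriv φ x • u x = ∫ x, deriv φ x • u' x :=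
    integral_congr_ae (by filter_upwards [hu] with x hx; rw [hx])
  have h2 : ∫ x, φ x • g x = ∫ x, φ x • g' x :=
    integral_congr_ae (by filter_upwards [hg] with x hx; rw [hx])
  rw [← h1, ← h2]; exact h φ hφ hc

lemma HasWeakDeriv.add {u g v k : ℝ → E} (hu : HasWeakDeriv u g) (hv : HasWeakDeriv v k)
    (hul : LocallyIntegrable u) (hgl : LocallyIntegrable g)
    (hvl : LocallyIntegrable v) (hkl : LocallyIntegrable k) :
    HasWeakDeriv (fun x => u x + v x) (fun x => g x + k x) := by
  intro φ hφ hc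
  simp only [smul_add]
  rw [integral_add (integrable_test_smul hul hφ hc).2 (integrable_test_smul hvl hφ hc).2,
    integral_add (integrable_test_smul hgl hφ hc).1 (integrable_test_smul hkl hφ hc).1,
    hu φ hφ hc, hv φ hφ hc, neg_add]

lemma HasWeakDeriv.smul {u g : ℝ → ℂ} (hu : HasWeakDeriv u g) (c : ℂ) :
    HasWeakDeriv (fun x => c * u x) (fun x => c * g x) := by
  intro φ hφ hc
  have := hu φ hφ hc
  simp only [Complex.real_smul] at this ⊢
  simp only [mul_left_comm _ c]
  rw [integral_const_mul, integral_const_mul, this, mul_neg]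

lemma HasWeakDeriv.unique [CompleteSpace E] {u g k : ℝ → E} (hg : HasWeakDeriv u g)
    (hk : HasWeakDeriv u k) (hgl : LocallyIntegrable g) (hkl : LocallyIntegrable k) :
    g =ᵐ[volume] k :=
  ae_eq_of_integral_contDiff_smul_eq hgl hkl fun φ hφ hc =>
    neg_injective ((hg φ hφ hc).symm.trans (hk φ hφ hc))

lemma hasWeakDeriv_primitive_real {g : ℝ → ℝ} (hg : LocallyIntegrable g) :
    HasWeakDeriv (fun x => ∫ t in (0 : ℝ)..x, g t) g := by
  intro φ hφ hc
  obtain ⟨R, hR⟩ := hc.isCompact.isBounded.subset_closedBall 0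
  set S : ℝ := max R 0 + 1 with hS
  have hSpos : 0 < S := by positivity
  have hout : ∀ x, x ∉ Ioc (-S) S → φ x = 0 ∧ deriv φ x = 0 := by
    intro x hx
    have : x ∉ tsupport φ := by
      intro h
      have h1 := hR h
      rw [Metric.mem_closedBall, dist_zero_right, Real.norm_eq_abs] at h1
      apply hx
      have := abs_le.1 h1
      have := le_max_left R 0
      constructor <;> linarith
    exact ⟨image_eq_zero_of_notMem_tsupport this,
      image_eq_zero_of_notMem_tsupport (fun h => this (tsupport_deriv_subset h))⟩
  have hends : φ S = 0 ∧ φ (-S) = 0 := by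
    have hS' : S ∉ tsupport φ := by
      intro h
      have h1 := hR h
      rw [Metric.mem_closedBall, dist_zero_right, Real.norm_eq_abs, abs_of_pos hSpos] at h1
      have := le_max_left R 0
      linarith
    exact ⟨image_eq_zero_of_notMem_tsupport hS', (hout (-S) (by simp)).1⟩
  have e : ∀ f : ℝ → ℝ, (∀ x, x ∉ Ioc (-S) S → f x = 0) → ∫ x, f x = ∫ x in (-S)..S, f x := by
    intro f hf
    rw [intervalIntegral.integral_of_le (by linarith)]
    exact (setIntegral_eq_integral_of_forall_compl_eq_zero hf).symm
  rw [e _ (fun x hx => by simp [(hout x hx).2]), e _ (fun x hx => by simp [(hout x hx).1])]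
  have hgi : ∀ a b, IntervalIntegrable g volume a b := fun a b =>
    (hg.integrableOn_isCompact isCompact_uIcc).intervalIntegrable
  have hG : AbsolutelyContinuousOnInterval (fun x => ∫ t in (0 : ℝ)..x, g t) (-S) S :=
    (hgi _ _).absolutelyContinuousOnInterval_intervalIntegral
      (by rw [uIcc_of_le (by linarith)]; constructor <;> linarith)
  have hφa : AbsolutelyContinuousOnInterval φ (-S) S :=
    (hφ.of_le (by simp)).contDiffOn.absolutelyContinuousOnInterval
  have key := hφa.integral_mul_deriv_eq_deriv_mul hG
  have h2 : ∫ x in (-S)..S, φ x * deriv (fun x => ∫ t in (0 : ℝ)..x, g t) x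
      = ∫ x in (-S)..S, φ x • g x := by
    apply intervalIntegral.integral_congr_ae
    filter_upwards [LocallyIntegrable.ae_hasDerivAt_integral hg] with x hx _
    rw [(hx 0).deriv, smul_eq_mul]
  rw [h2, hends.1, hends.2] at key
  simp only [smul_eq_mul] at key ⊢
  rw [key]; simp

end

lemma hasWeakDeriv_primitive {g : ℝ → ℂ} (hg : LocallyIntegrable g) :
    HasWeakDeriv (fun x => ∫ t in (0 : ℝ)..x, g t) g := by
  intro φ hφ hc
  have hgi : ∀ a b, IntervalIntegrable g volume a b := fun a b =>
    (hg.integrableOn_isCompact isCompact_uIcc).intervalIntegrable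
  have hGl : LocallyIntegrable (fun x => ∫ t in (0 : ℝ)..x, g t) :=
    (intervalIntegral.continuous_primitive hgi 0).locallyIntegrable
  have key : ∀ L : ℂ →L[ℝ] ℝ, L (∫ x, deriv φ x • ∫ t in (0 : ℝ)..x, g t)
      = L (-∫ x, φ x • g x) := by
    intro L
    have hLg : LocallyIntegrable (fun x => L (g x)) := by
      intro x
      obtain ⟨s, hs, h⟩ := hg x
      exact ⟨s, hs, L.integrable_comp h⟩
    have := hasWeakDeriv_primitive_real hLg φ hφ hc
    rw [map_neg, ← L.integral_comp_comm (integrable_test_smul hGl hφ hc).2,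
      ← L.integral_comp_comm (integrable_test_smul hg hφ hc).1]
    simp only [map_smul]
    rw [← this]
    congr 1; ext x
    simp only [L.intervalIntegral_comp_comm (hgi 0 x)]
  exact Complex.ext (key Complex.reCLM) (key Complex.imCLM)

lemma HasWeakDeriv.ae_eq_const {h : ℝ → ℂ} (hl : LocallyIntegrable h)
    (hw : HasWeakDeriv h (fun _ => 0)) : ∃ c : ℂ, h =ᵐ[volume] fun _ => c := by
  let b : ContDiffBump (0 : ℝ) := default
  set ψ : ℝ → ℝ := b.normed volume with hψ
  have ψs : ContDiff ℝ ∞ ψ := b.contDiff_normed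
  have ψc : HasCompactSupport ψ := b.hasCompactSupport_normed
  have ψi : ∫ x, ψ x = 1 := b.integral_normed
  refine ⟨∫ x, ψ x • h x, ?_⟩
  refine ae_eq_of_integral_contDiff_smul_eq hl (continuous_const.locallyIntegrable) ?_
  intro φ hφ hc
  set m : ℝ := ∫ x, φ x with hm
  set η : ℝ → ℝ := fun x => φ x - m * ψ x with hη
  have ηs : ContDiff ℝ ∞ η := hφ.sub (contDiff_const.mul ψs)
  have ηc : HasCompactSupport η := by
    have : HasCompactSupport (fun x => m * ψ x) := ψc.mul_left
    exact hc.sub this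
  have φi : Integrable φ := hφ.continuous.integrable_of_hasCompactSupport hc
  have ψint : Integrable ψ := ψs.continuous.integrable_of_hasCompactSupport ψc
  have ηi : Integrable η := ηs.continuous.integrable_of_hasCompactSupport ηc
  have η0 : ∫ x, η x = 0 := by
    rw [hη, integral_sub φi (ψint.const_mul m), integral_const_mul, ψi, mul_one, hm, sub_self]
  obtain ⟨R, hR⟩ := ηc.isCompact.isBounded.subset_closedBall 0
  have hout : ∀ x, R < |x| → η x = 0 := by
    intro x hx
    refine image_eq_zero_of_notMem_tsupport fun h => ?_
    have h1 := hR h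
    rw [Metric.mem_closedBall, dist_zero_right, Real.norm_eq_abs] at h1
    linarith
  set Φ : ℝ → ℝ := fun x => ∫ t in (-R)..x, η t with hΦ
  have dΦ : ∀ x, HasDerivAt Φ (η x) x := fun x =>
    intervalIntegral.integral_hasDerivAt_right (ηs.continuous.intervalIntegrable _ _)
      (ηs.continuous.stronglyMeasurableAtFilter _ _) ηs.continuous.continuousAt
  have deqΦ : deriv Φ = η := funext fun x => (dΦ x).deriv
  have Φs : ContDiff ℝ ∞ Φ :=
    contDiff_infty_iff_deriv.2 ⟨fun x => (dΦ x).differentiableAt, deqΦ ▸ ηs⟩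
  have Φc : HasCompactSupport Φ := by
    refine HasCompactSupport.intro (isCompact_Icc (a := -|R|) (b := |R|)) ?_
    intro x hx
    have hxR : |R| < |x| := by
      rw [mem_Icc, ← abs_le] at hx; exact not_le.1 hx
    rcases le_or_gt 0 x with h0 | h0
    · rw [abs_of_nonneg h0] at hxR
      have hle : -R ≤ x := (neg_le_abs R).trans hxR.le
      rw [hΦ]
      simp only
      rw [intervalIntegral.integral_of_le hle, setIntegral_eq_integral_of_ae_compl_eq_zero, η0]
      have : ∀ᵐ y : ℝ, y ≠ -R := by simp [ae_iff]
      filter_upwards [this] with y hy hy'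
      apply hout
      rw [mem_Ioc, not_and_or, not_lt, not_le] at hy'
      rcases hy' with h | h
      · have : y < -R := lt_of_le_of_ne h hy
        exact lt_of_lt_of_le (by linarith) (neg_le_abs y)
      · exact lt_of_lt_of_le (lt_of_le_of_lt (le_abs_self R) (hxR.trans h)) (le_abs_self y)
    · rw [abs_of_neg h0] at hxR
      have hle : x ≤ -R := by have := le_abs_self R; linarith
      rw [hΦ]
      simp only
      rw [intervalIntegral.integral_symm, intervalIntegral.integral_of_le hle, neg_eq_zero]
      have : ∀ᵐ y : ℝ, y ≠ -R := by simp [ae_iff]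
      refine setIntegral_eq_zero_of_ae_eq_zero ?_
      filter_upwards [this] with y hy hy'
      apply hout
      exact lt_of_lt_of_le (by have := lt_of_le_of_ne hy'.2 hy; linarith) (neg_le_abs y)
  have key := hw Φ Φs Φc
  rw [deqΦ] at key
  have φhi := (integrable_test_smul hl hφ hc).1
  have ψhi := (integrable_test_smul hl ψs ψc).1
  simp only [smul_zero, integral_zero, neg_zero, hη, sub_smul, mul_smul] at key
  have e1 : ∫ x, (φ x • h x - m • ψ x • h x) = (∫ x, φ x • h x) - ∫ x, m • ψ x • h x :=
    integral_sub φhi (ψhi.smul m)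
  rw [e1, integral_smul, sub_eq_zero] at key
  rw [key, integral_smul_const]

/-! ### Sobolev space -/

/-- The complex Hilbert space `L_2(ℝ)`. -/
abbrev L2 : Type := Lp ℂ 2 (volume : Measure ℝ)

lemma L2.locallyIntegrable (u : L2) : LocallyIntegrable (u : ℝ → ℂ) :=
  (Lp.memLp u).locallyIntegrable (by norm_num)

/-- The Sobolev space `W_2^1(ℝ)`: the `u ∈ L_2(ℝ)` with a distributional derivative in
`L_2(ℝ)`. -/
def sobolev : Submodule ℂ L2 where
  carrier := {u | ∃ g : L2, HasWeakDeriv (u : ℝ → ℂ) (g : ℝ → ℂ)}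
  add_mem' := by
    rintro u v ⟨g, hg⟩ ⟨k, hk⟩
    exact ⟨g + k, (hg.add hk u.locallyIntegrable g.locallyIntegrable v.locallyIntegrable
      k.locallyIntegrable).congr (Lp.coeFn_add u v).symm (Lp.coeFn_add g k).symm⟩
  zero_mem' := by
    refine ⟨0, ?_⟩
    have : HasWeakDeriv (fun _ : ℝ => (0 : ℂ)) (fun _ => 0) := by intro φ _ _; simp
    exact this.congr (Lp.coeFn_zero ..).symm (Lp.coeFn_zero ..).symm
  smul_mem' := by
    rintro c u ⟨g, hg⟩
    exact ⟨c • g, (hg.smul c).congr (Lp.coeFn_smul c u).symm (Lp.coeFn_smul c g).symm⟩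

/-- The weak derivative of `u ∈ W_2^1(ℝ)` (unique by `weakDeriv_eq`). -/
noncomputable def weakDeriv (u : sobolev) : L2 := u.2.choose

lemma hasWeakDeriv_weakDeriv (u : sobolev) :
    HasWeakDeriv ((u : L2) : ℝ → ℂ) (weakDeriv u : ℝ → ℂ) := u.2.choose_spec

lemma weakDeriv_eq {u : sobolev} {g : L2} (h : HasWeakDeriv ((u : L2) : ℝ → ℂ) (g : ℝ → ℂ)) :
    weakDeriv u = g :=
  Lp.ext ((hasWeakDeriv_weakDeriv u).unique h (weakDeriv u).locallyIntegrable g.locallyIntegrable)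

lemma weakDeriv_add (u v : sobolev) : weakDeriv (u + v) = weakDeriv u + weakDeriv v :=
  weakDeriv_eq (((hasWeakDeriv_weakDeriv u).add (hasWeakDeriv_weakDeriv v)
    (u : L2).locallyIntegrable (weakDeriv u).locallyIntegrable (v : L2).locallyIntegrable
    (weakDeriv v).locallyIntegrable).congr (Lp.coeFn_add (u : L2) (v : L2)).symm
    (Lp.coeFn_add _ _).symm)

lemma weakDeriv_smul (c : ℂ) (u : sobolev) : weakDeriv (c • u) = c • weakDeriv u :=
  weakDeriv_eq (((hasWeakDeriv_weakDeriv u).smul c).congr (Lp.coeFn_smul c (u : L2)).symm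
    (Lp.coeFn_smul c (weakDeriv u)).symm)

lemma L2.intervalIntegrable (g : L2) (a b : ℝ) : IntervalIntegrable (g : ℝ → ℂ) volume a b :=
  (g.locallyIntegrable.integrableOn_isCompact isCompact_uIcc).intervalIntegrable

lemma exists_primitive (u : sobolev) : ∃ c : ℂ,
    ((u : L2) : ℝ → ℂ) =ᵐ[volume] fun x => c + ∫ t in (0 : ℝ)..x, weakDeriv u t := by
  set g := weakDeriv u
  have hgl := g.locallyIntegrable
  have hP := (hasWeakDeriv_primitive hgl).smul (-1)
  have hPl : LocallyIntegrable (fun x => -1 * ∫ t in (0 : ℝ)..x, g t) :=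
    (continuous_const.mul
      (intervalIntegral.continuous_primitive g.intervalIntegrable 0)).locallyIntegrable
  have hgn : LocallyIntegrable (fun x => -1 * g x) := by
    simp only [neg_one_mul]; exact hgl.neg
  have h := (hasWeakDeriv_weakDeriv u).add hP (u : L2).locallyIntegrable hgl hPl hgn
  have h0 : HasWeakDeriv (fun x => (u : L2) x + -1 * ∫ t in (0 : ℝ)..x, g t) (fun _ => 0) :=
    h.congr (ae_eq_refl _) (Eventually.of_forall fun x => by simp [g])
  obtain ⟨c, hc⟩ := h0.ae_eq_const ((u : L2).locallyIntegrable.add hPl)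
  refine ⟨c, ?_⟩
  filter_upwards [hc] with x hx
  rw [← hx, Pi.add_apply]; ring

lemma exists_contRep (u : sobolev) :
    ∃ w : ℝ → ℂ, Continuous w ∧ ((u : L2) : ℝ → ℂ) =ᵐ[volume] w := by
  obtain ⟨c, hc⟩ := exists_primitive u
  exact ⟨_, continuous_const.add
    (intervalIntegral.continuous_primitive (weakDeriv u).intervalIntegrable 0), hc⟩

/-- The continuous representative of `u ∈ W_2^1(ℝ)` (unique by `contRep_eq`). -/
noncomputable def contRep (u : sobolev) : ℝ → ℂ := (exists_contRep u).choose

lemma continuous_contRep (u : sobolev) : Continuous (contRep u) := (exists_contRep u).choose_spec.1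

lemma coe_ae_eq_contRep (u : sobolev) : ((u : L2) : ℝ → ℂ) =ᵐ[volume] contRep u :=
  (exists_contRep u).choose_spec.2

lemma contRep_eq {u : sobolev} {w : ℝ → ℂ} (hw : Continuous w)
    (h : ((u : L2) : ℝ → ℂ) =ᵐ[volume] w) : contRep u = w :=
  (Continuous.ae_eq_iff_eq volume (continuous_contRep u) hw).1 ((coe_ae_eq_contRep u).symm.trans h)

lemma contRep_add (u v : sobolev) : contRep (u + v) = contRep u + contRep v :=
  contRep_eq ((continuous_contRep u).add (continuous_contRep v))
    ((Lp.coeFn_add (u : L2) (v : L2)).trans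
      ((coe_ae_eq_contRep u).add (coe_ae_eq_contRep v)))

lemma contRep_smul (c : ℂ) (u : sobolev) : contRep (c • u) = c • contRep u :=
  contRep_eq ((continuous_contRep u).const_smul c)
    ((Lp.coeFn_smul c (u : L2)).trans ((coe_ae_eq_contRep u).const_smul c))

lemma contRep_sub_eq_integral (u : sobolev) (x y : ℝ) :
    contRep u x - contRep u y = ∫ t in y..x, weakDeriv u t := by
  obtain ⟨c, hc⟩ := exists_primitive u
  rw [contRep_eq (continuous_const.add
    (intervalIntegral.continuous_primitive (weakDeriv u).intervalIntegrable 0)) hc]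
  show (c + ∫ t in (0 : ℝ)..x, weakDeriv u t) - (c + ∫ t in (0 : ℝ)..y, weakDeriv u t) = _
  rw [add_sub_add_left_eq_sub]
  exact intervalIntegral.integral_interval_sub_left (L2.intervalIntegrable _ _ _)
    (L2.intervalIntegrable _ _ _)

lemma memLp_contRep (u : sobolev) : MemLp (contRep u) 2 volume :=
  (memLp_congr_ae (coe_ae_eq_contRep u)).1 (Lp.memLp (u : L2))

lemma volume_cell (k : ℤ) : volume (Ioc (k : ℝ) (k + 1)) = 1 := by simp

/-- A quantitative form of the embedding into continuous functions, on unit cells. -/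
lemma enorm_contRep_sq_le (u : sobolev) (k : ℤ) {x : ℝ} (hx : x ∈ Ioc (k : ℝ) (k + 1)) :
    ‖contRep u x‖ₑ ^ 2 ≤ 2 * ∫⁻ y in Ioc (k : ℝ) (k + 1),
      (‖contRep u y‖ₑ ^ 2 + ‖weakDeriv u y‖ₑ ^ 2) := by
  set C := Ioc (k : ℝ) (k + 1)
  have hprob : IsProbabilityMeasure (volume.restrict C) :=
    ⟨by rw [Measure.restrict_apply_univ]; exact volume_cell k⟩
  set M : ℝ≥0∞ := ∫⁻ t in C, ‖weakDeriv u t‖ₑ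
  have hM : M ^ 2 ≤ ∫⁻ t in C, ‖weakDeriv u t‖ₑ ^ 2 := by
    have h := eLpNorm_le_eLpNorm_of_exponent_le (μ := volume.restrict C) (p := 1) (q := 2)
      (by norm_num) (Lp.aestronglyMeasurable (weakDeriv u)).restrict
    rw [eLpNorm_one_eq_lintegral_enorm] at h
    have h2 := pow_le_pow_left₀ zero_le h 2
    have e := eLpNorm_nnreal_pow_eq_lintegral (f := (weakDeriv u : ℝ → ℂ))
      (μ := volume.restrict C) (p := 2) (by norm_num)
    norm_num at e
    rw [e] at h2
    exact h2
  have hpt : ∀ y ∈ C, ‖contRep u x‖ₑ ^ 2 ≤ 2 * (‖contRep u y‖ₑ ^ 2 + M ^ 2) := by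
    intro y hy
    have h1 : ‖contRep u x - contRep u y‖ₑ ≤ M := by
      rw [contRep_sub_eq_integral]
      have : ‖∫ t in y..x, weakDeriv u t‖ₑ ≤ ∫⁻ t in uIoc y x, ‖weakDeriv u t‖ₑ := by
        rw [← enorm_norm, intervalIntegral.norm_intervalIntegral_eq, enorm_norm]
        exact enorm_integral_le_lintegral_enorm _
      refine this.trans (lintegral_mono_set ?_)
      intro t ht
      rw [mem_uIoc] at ht
      rcases ht with ht | ht
      · exact ⟨hy.1.trans ht.1, ht.2.trans hx.2⟩
      · exact ⟨hx.1.trans ht.1, ht.2.trans hy.2⟩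
    have h2 : ‖contRep u x‖ₑ ≤ ‖contRep u y‖ₑ + M := by
      calc ‖contRep u x‖ₑ = ‖contRep u y + (contRep u x - contRep u y)‖ₑ := by
            rw [add_sub_cancel]
        _ ≤ _ := (enorm_add_le _ _).trans (by gcongr)
    calc ‖contRep u x‖ₑ ^ 2 ≤ (‖contRep u y‖ₑ + M) ^ 2 := by gcongr
      _ ≤ 2 * (‖contRep u y‖ₑ ^ 2 + M ^ 2) := by
        have := ENNReal.rpow_add_le_mul_rpow_add_rpow (‖contRep u y‖ₑ) M
          (p := 2) (by norm_num)
        norm_num at this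
        exact this
  calc ‖contRep u x‖ₑ ^ 2 = ∫⁻ _ in C, ‖contRep u x‖ₑ ^ 2 := by simp
    _ ≤ ∫⁻ y in C, 2 * (‖contRep u y‖ₑ ^ 2 + M ^ 2) :=
        setLIntegral_mono' measurableSet_Ioc hpt
    _ = 2 * ((∫⁻ y in C, ‖contRep u y‖ₑ ^ 2) + M ^ 2) := by
        rw [lintegral_const_mul' _ _ (by norm_num), lintegral_add_right' _ aemeasurable_const]
        simp
    _ ≤ 2 * ((∫⁻ y in C, ‖contRep u y‖ₑ ^ 2) + ∫⁻ t in C, ‖weakDeriv u t‖ₑ ^ 2) := by gcongr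
    _ = _ := by
        rw [lintegral_add_left']
        exact ((continuous_contRep u).aestronglyMeasurable.enorm.pow_const 2)


/-! ### Form and operator -/

/-- The uniformly locally bounded local measures. -/
abbrev ULBMeasure : Type := {μ : LocalMeasure // μ.unifNorm < ⊤}

lemma memLp_contRep_variation (μ : ULBMeasure) (u : sobolev) :
    MemLp (contRep u) 2 μ.1.variation := by
  refine ⟨(continuous_contRep u).aestronglyMeasurable, ?_⟩
  have e := fun ν : Measure ℝ => eLpNorm_nnreal_pow_eq_lintegral (f := contRep u) (μ := ν) (p := 2)
    (by norm_num)
  have e' := fun ν : Measure ℝ => eLpNorm_nnreal_pow_eq_lintegral (f := (weakDeriv u : ℝ → ℂ))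
    (μ := ν) (p := 2) (by norm_num)
  norm_num at e e'
  have hfin : ∫⁻ x, ‖contRep u x‖ₑ ^ 2 ∂μ.1.variation < ⊤ := by
    have hC : ∀ k : ℤ, MeasurableSet (Ioc (k : ℝ) (k + 1)) := fun k => measurableSet_Ioc
    have split : ∀ (ν : Measure ℝ) (f : ℝ → ℝ≥0∞),
        ∫⁻ x, f x ∂ν = ∑' k : ℤ, ∫⁻ x in Ioc (k : ℝ) (k + 1), f x ∂ν := fun ν f => by
      rw [← lintegral_iUnion hC (pairwise_disjoint_Ioc_intCast ℝ), iUnion_Ioc_intCast,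
        Measure.restrict_univ]
    set F : ℝ → ℝ≥0∞ := fun y => ‖contRep u y‖ₑ ^ 2 + ‖weakDeriv u y‖ₑ ^ 2
    have hF : ∫⁻ y, F y < ⊤ := by
      rw [lintegral_add_left' ((continuous_contRep u).aestronglyMeasurable.enorm.pow_const 2)]
      rw [← e, ← e']
      exact ENNReal.add_lt_top.2 ⟨ENNReal.pow_lt_top (memLp_contRep u).2,
        ENNReal.pow_lt_top (Lp.memLp (weakDeriv u)).2⟩
    calc ∫⁻ x, ‖contRep u x‖ₑ ^ 2 ∂μ.1.variation
        = ∑' k : ℤ, ∫⁻ x in Ioc (k : ℝ) (k + 1), ‖contRep u x‖ₑ ^ 2 ∂μ.1.variation := split _ _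
      _ ≤ ∑' k : ℤ, μ.1.unifNorm * (2 * ∫⁻ y in Ioc (k : ℝ) (k + 1), F y) := by
        refine ENNReal.tsum_le_tsum fun k => ?_
        calc ∫⁻ x in Ioc (k : ℝ) (k + 1), ‖contRep u x‖ₑ ^ 2 ∂μ.1.variation
            ≤ ∫⁻ _ in Ioc (k : ℝ) (k + 1), (2 * ∫⁻ y in Ioc (k : ℝ) (k + 1), F y)
                ∂μ.1.variation := setLIntegral_mono' (hC k) fun x hx => enorm_contRep_sq_le u k hx
          _ = (2 * ∫⁻ y in Ioc (k : ℝ) (k + 1), F y) * μ.1.variation (Ioc (k : ℝ) (k + 1)) := by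
            rw [setLIntegral_const]
          _ ≤ _ := by
            rw [mul_comm]
            gcongr
            exact le_iSup (fun t : ℝ => μ.1.variation (Ioc t (t + 1))) (k : ℝ)
      _ = μ.1.unifNorm * (2 * ∫⁻ y, F y) := by
        rw [ENNReal.tsum_mul_left, ENNReal.tsum_mul_left, ← split]
      _ < ⊤ := ENNReal.mul_lt_top μ.2 (ENNReal.mul_lt_top (by norm_num) hF)
  rw [← e] at hfin
  by_contra h
  rw [not_lt, top_le_iff] at h
  simp [h] at hfin

lemma integrable_contRep_mul (μ : ULBMeasure) (u v : sobolev) :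
    Integrable (fun x => contRep u x * conj (contRep v x)) μ.1.variation :=
  (memLp_contRep_variation μ u).integrable_mul (memLp_contRep_variation μ v).star

/-- The form `∫ u' v̄' + ∫ u v̄ dμ` with domain `W_2^1(ℝ)`, in which `u` and `v` are integrated
against `μ` through their continuous representatives. -/
noncomputable def form (μ : ULBMeasure) (u v : sobolev) : ℂ :=
  (∫ x, weakDeriv u x * conj (weakDeriv v x)) +
    μ.1.integral fun x => contRep u x * conj (contRep v x)

lemma integrable_weakDeriv_mul (u v : sobolev) :
    Integrable (fun x => weakDeriv u x * conj (weakDeriv v x)) :=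
  (Lp.memLp (weakDeriv u)).integrable_mul (Lp.memLp (weakDeriv v)).star

lemma integrable_parts (μ : ULBMeasure) (u v : sobolev) :
    Integrable (fun x => contRep u x * conj (contRep v x)) μ.1.posPart ∧
    Integrable (fun x => contRep u x * conj (contRep v x)) μ.1.negPart :=
  integrable_add_measure.1 (integrable_contRep_mul μ u v)

lemma form_add_left (μ : ULBMeasure) (u u' v : sobolev) :
    form μ (u + u') v = form μ u v + form μ u' v := by
  have h1 : ∫ x, weakDeriv (u + u') x * conj (weakDeriv v x) =
      (∫ x, weakDeriv u x * conj (weakDeriv v x)) +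
        ∫ x, weakDeriv u' x * conj (weakDeriv v x) := by
    rw [← integral_add (integrable_weakDeriv_mul u v) (integrable_weakDeriv_mul u' v)]
    refine integral_congr_ae ?_
    rw [weakDeriv_add]
    filter_upwards [Lp.coeFn_add (weakDeriv u) (weakDeriv u')] with x hx
    rw [hx, Pi.add_apply, add_mul]
  rw [form, h1, form, form, LocalMeasure.integral, LocalMeasure.integral, LocalMeasure.integral,
    contRep_add]
  simp only [Pi.add_apply, add_mul]
  rw [integral_add (integrable_parts μ u v).1 (integrable_parts μ u' v).1,
    integral_add (integrable_parts μ u v).2 (integrable_parts μ u' v).2]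
  ring

lemma form_smul_left (μ : ULBMeasure) (c : ℂ) (u v : sobolev) :
    form μ (c • u) v = c * form μ u v := by
  have h1 : ∫ x, weakDeriv (c • u) x * conj (weakDeriv v x) =
      c * ∫ x, weakDeriv u x * conj (weakDeriv v x) := by
    rw [← integral_const_mul]
    refine integral_congr_ae ?_
    rw [weakDeriv_smul]
    filter_upwards [Lp.coeFn_smul c (weakDeriv u)] with x hx
    rw [hx, Pi.smul_apply, smul_eq_mul, mul_assoc]
  rw [form, h1, form, LocalMeasure.integral, LocalMeasure.integral, contRep_smul]
  simp only [Pi.smul_apply, smul_eq_mul, mul_assoc]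
  rw [integral_const_mul, integral_const_mul]
  ring

/-- The graph of the operator associated with the form: `(u, f)` belongs to it if and only if
`u ∈ W_2^1(ℝ)` and `⟨f, v⟩ = form μ u v` for all `v ∈ W_2^1(ℝ)`, where `⟨f, v⟩ = ∫ f v̄`
is `inner ℂ v f`, as Mathlib's inner product is conjugate-linear in its first argument. -/
def schrodingerGraph (μ : ULBMeasure) : Submodule ℂ (L2 × L2) where
  carrier := {p | ∃ u : sobolev, (u : L2) = p.1 ∧
    ∀ v : sobolev, inner ℂ (v : L2) p.2 = form μ u v}
  add_mem' := by
    rintro p q ⟨u, hu, hu'⟩ ⟨w, hw, hw'⟩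
    refine ⟨u + w, by simp [hu, hw], fun v => ?_⟩
    rw [form_add_left, Prod.snd_add, inner_add_right, hu', hw']
  zero_mem' := by
    refine ⟨0, rfl, fun v => ?_⟩
    have := form_smul_left μ 0 0 v
    rw [zero_smul, zero_mul] at this
    simp [this]
  smul_mem' := by
    rintro c p ⟨u, hu, hu'⟩
    refine ⟨c • u, by simp [hu], fun v => ?_⟩
    rw [form_smul_left, Prod.smul_snd, inner_smul_right, hu']

lemma exists_sobolev_of_test {φ : ℝ → ℝ} (hφ : ContDiff ℝ ∞ φ) (hc : HasCompactSupport φ) :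
    ∃ v : sobolev, ((v : L2) : ℝ → ℂ) =ᵐ[volume] fun x => (φ x : ℂ) := by
  have m : ∀ ψ : ℝ → ℝ, Continuous ψ → HasCompactSupport ψ →
      MemLp (fun x => (ψ x : ℂ)) 2 volume := fun ψ h1 h2 =>
    (Complex.continuous_ofReal.comp h1).memLp_of_hasCompactSupport
      (h2.comp_left (g := fun r : ℝ => (r : ℂ)) Complex.ofReal_zero)
  have hφ' := (contDiff_infty_iff_deriv.1 hφ).2
  refine ⟨⟨(m φ hφ.continuous hc).toLp, (m _ hφ'.continuous hc.deriv).toLp, ?_⟩,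
    (m φ hφ.continuous hc).coeFn_toLp⟩
  refine HasWeakDeriv.congr ?_ (m φ hφ.continuous hc).coeFn_toLp.symm
    (m _ hφ'.continuous hc.deriv).coeFn_toLp.symm
  intro η hη hηc
  simp only [Complex.real_smul]
  norm_cast
  have ibp := integral_mul_deriv_eq_deriv_mul_of_integrable (u := φ) (v := η) (u' := deriv φ)
    (v' := deriv η)
    (fun x _ => ((contDiff_infty_iff_deriv.1 hφ).1 x).hasDerivAt)
    (fun x _ => ((contDiff_infty_iff_deriv.1 hη).1 x).hasDerivAt)
    ((hφ.continuous.mul (contDiff_infty_iff_deriv.1 hη).2.continuous).integrable_of_hasCompactSupport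
      hc.mul_right)
    ((hφ'.continuous.mul hη.continuous).integrable_of_hasCompactSupport hηc.mul_left)
    ((hφ.continuous.mul hη.continuous).integrable_of_hasCompactSupport hc.mul_right)
  simp only [mul_comm (deriv η _), mul_comm (η _)]
  exact_mod_cast ibp

lemma schrodingerGraph_snd_eq_zero (μ : ULBMeasure) (p : L2 × L2) (hp : p ∈ schrodingerGraph μ)
    (h0 : p.1 = 0) : p.2 = 0 := by
  obtain ⟨u, hu, h⟩ := hp
  have hu0 : u = 0 := Subtype.ext (hu.trans h0)
  have hf : ∀ v : sobolev, inner ℂ (v : L2) p.2 = 0 := fun v => by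
    have := form_smul_left μ 0 0 v
    rw [zero_smul, zero_mul] at this
    rw [h v, hu0, this]
  suffices key : (p.2 : ℝ → ℂ) =ᵐ[volume] 0 from
    Lp.ext (key.trans (Lp.coeFn_zero ..).symm)
  refine ae_eq_zero_of_integral_contDiff_smul_eq_zero p.2.locallyIntegrable ?_
  intro φ hφ hc
  obtain ⟨v, hv⟩ := exists_sobolev_of_test hφ hc
  rw [← hf v, L2.inner_def]
  refine integral_congr_ae ?_
  filter_upwards [hv] with x hx
  rw [hx]
  simp [mul_comm]

/-- The operator `H_μ = -Δ + μ` associated with the form; its graph is `schrodingerGraph μ` by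
`graph_schrodinger`. -/
noncomputable def schrodinger (μ : ULBMeasure) : L2 →ₗ.[ℂ] L2 := (schrodingerGraph μ).toLinearPMap

lemma graph_schrodinger (μ : ULBMeasure) : (schrodinger μ).graph = schrodingerGraph μ :=
  Submodule.toLinearPMap_graph_eq _ fun p hp h0 => schrodingerGraph_snd_eq_zero μ p hp h0

section Resolvent
variable {E : Type*} [NormedAddCommGroup E] [NormedSpace ℂ E]

/-- `R` is the bounded, everywhere defined, two-sided inverse of `T - z`. -/
def IsResolventAt (T : E →ₗ.[ℂ] E) (z : ℂ) (R : E →L[ℂ] E) : Prop :=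
  (∀ f : E, ∃ u : T.domain, (u : E) = R f ∧ T u - z • (u : E) = f) ∧
    ∀ u : T.domain, R (T u - z • (u : E)) = u

/-- Strong resolvent convergence: for every non-real `z` the resolvents at `z` exist as bounded
operators and converge strongly. -/
def StrongResolventTendsto (T : ℕ → E →ₗ.[ℂ] E) (S : E →ₗ.[ℂ] E) : Prop :=
  ∀ z : ℂ, z.im ≠ 0 → ∃ (R : ℕ → E →L[ℂ] E) (R₀ : E →L[ℂ] E),
    (∀ n, IsResolventAt (T n) z (R n)) ∧ IsResolventAt S z R₀ ∧
      ∀ f : E, Tendsto (fun n => R n f) atTop (𝓝 (R₀ f))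

end Resolvent

end MeasureSchrodinger

namespace MeasureSchrodinger

/-! ### Local estimates -/

/-! Everything rests on bounds that depend on the measure only through an upper bound `K` for its
uniform local norm. On a cell of length `ℓ ≤ 1` the fundamental theorem of calculus bounds `|u|²`
pointwise by `(2/ℓ) ∫ |u|² + 2ℓ ∫ |u'|²` over that cell. Each cell has `|μ|`-mass at most `K`, so
summation gives `∫ |u|² d|μ| ≤ K ((2/ℓ) ‖u‖² + 2ℓ ‖u'‖²)`. A small `ℓ` makes the potential a small
perturbation of `∫ |u'|²`, and for non-real `z` the form `τ_μ - z` is coercive on `W_2^1` with a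
constant depending only on `K` and `z` (`exists_coercive`). Lax-Milgram makes `H_μ - z` surjective;
with symmetry this yields self-adjointness and bounded resolvents.

For the convergence, let `u` and `w` be the resolvents of `H_μ` and `H_{μ_n}` applied to the same
`f`, and `d = w - u`. Subtracting the weak equations gives `(τ_{μ_n} - z)(d, d) = -(τ_{μ_n} -
τ_μ)(u, d)`. By uniform coercivity it suffices that, for fixed `u`, `|(τ_{μ_n} - τ_μ)(u, v)| ≤ ε
‖v‖` for large `n` and all `v` in `W_2^1` simultaneously (`eventually_norm_form_sub_le`); uniformity
in `v` is essential because `d` changes with `n`.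

Far out, the difference is small because the fixed `u` has a small Sobolev tail (`exists_cutoff`).
On a compact set, bounded families in `W_2^1` are uniformly bounded and uniformly Hölder continuous
of order `1/2`. Hence `v` is close to a combination of finitely many fixed bump functions, and vague
convergence is needed only for these (`eventually_norm_integral_mul_sub_le`). -/

lemma lintegral_mul_sq_le {α : Type*} [MeasurableSpace α] {ν : Measure α} {f g : α → ℝ≥0∞}
    (hf : AEMeasurable f ν) (hg : AEMeasurable g ν) :
    (∫⁻ x, f x * g x ∂ν) ^ 2 ≤ (∫⁻ x, f x ^ 2 ∂ν) * ∫⁻ x, g x ^ 2 ∂ν := by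
  have h := pow_le_pow_left₀ zero_le
    (ENNReal.lintegral_mul_le_Lp_mul_Lq ν Real.HolderConjugate.two_two hf hg) 2
  simp only [Pi.mul_apply, mul_pow, ← ENNReal.rpow_natCast, ← ENNReal.rpow_mul] at h ⊢
  norm_num at h ⊢
  exact h

/-- Cauchy-Schwarz applied to `u x - u y = ∫ u'`. The right side involves only the given interval,
so that it can later be summed over disjoint cells. -/
lemma enorm_contRep_sub_sq_le_setLIntegral (u : sobolev) {a b x y : ℝ} (hx : x ∈ Icc a b)
    (hy : y ∈ Icc a b) :
    ‖contRep u x - contRep u y‖ₑ ^ 2 ≤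
      ENNReal.ofReal (b - a) * ∫⁻ t in Ioc a b, ‖weakDeriv u t‖ₑ ^ 2 := by
  have h1 : ‖contRep u x - contRep u y‖ₑ ≤ ∫⁻ t in Ioc a b, ‖weakDeriv u t‖ₑ := by
    rw [contRep_sub_eq_integral, ← enorm_norm, intervalIntegral.norm_intervalIntegral_eq,
      enorm_norm]
    refine (enorm_integral_le_lintegral_enorm _).trans (lintegral_mono_set ?_)
    exact Ioc_subset_Ioc (le_min hy.1 hx.1) (max_le hy.2 hx.2)
  have h2 := lintegral_mul_sq_le (ν := volume.restrict (Ioc a b)) (f := fun _ => 1)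
    (g := fun t => ‖weakDeriv u t‖ₑ) aemeasurable_const
    (Lp.aestronglyMeasurable (weakDeriv u)).restrict.enorm
  simp only [one_mul, one_pow, lintegral_one, Measure.restrict_apply_univ, Real.volume_Ioc] at h2
  exact (pow_le_pow_left₀ zero_le h1 2).trans h2

/-- The embedding into continuous functions, on intervals of arbitrary length. -/
lemma enorm_contRep_sq_le_setLIntegral (u : sobolev) {a b x : ℝ} (hx : x ∈ Ioc a b) :
    ‖contRep u x‖ₑ ^ 2 ≤ ∫⁻ y in Ioc a b, (2 * (ENNReal.ofReal (b - a))⁻¹ * ‖contRep u y‖ₑ ^ 2 +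
      2 * ENNReal.ofReal (b - a) * ‖weakDeriv u y‖ₑ ^ 2) := by
  set C := Ioc a b
  set L := ENNReal.ofReal (b - a) with hL
  have hab : 0 < b - a := by linarith [hx.1, hx.2]
  have hL0 : L ≠ 0 := (ENNReal.ofReal_pos.2 hab).ne'
  have hLt : L ≠ ⊤ := ENNReal.ofReal_ne_top
  have hvol : volume C = L := Real.volume_Ioc
  set D := ∫⁻ t in C, ‖weakDeriv u t‖ₑ ^ 2
  have hpt : ∀ y ∈ C, ‖contRep u x‖ₑ ^ 2 ≤ 2 * ‖contRep u y‖ₑ ^ 2 + 2 * (L * D) := by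
    intro y hy
    have h2 : ‖contRep u x‖ₑ ≤ ‖contRep u y‖ₑ + ‖contRep u x - contRep u y‖ₑ := by
      simpa using enorm_add_le (contRep u y) (contRep u x - contRep u y)
    have h3 := ENNReal.rpow_add_le_mul_rpow_add_rpow (‖contRep u y‖ₑ)
      (‖contRep u x - contRep u y‖ₑ) (p := 2) (by norm_num)
    norm_num at h3
    rw [← mul_add]
    refine (pow_le_pow_left₀ zero_le h2 2).trans (h3.trans ?_)
    gcongr
    exact enorm_contRep_sub_sq_le_setLIntegral u (Ioc_subset_Icc_self hx) (Ioc_subset_Icc_self hy)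
  -- Averaging over `y` in the cell trades the value at `y` for the local `L_2` norm.
  have hint : L * ‖contRep u x‖ₑ ^ 2 ≤ 2 * (∫⁻ y in C, ‖contRep u y‖ₑ ^ 2) + L * (2 * (L * D)) := by
    calc L * ‖contRep u x‖ₑ ^ 2 = ∫⁻ _ in C, ‖contRep u x‖ₑ ^ 2 := by
          rw [setLIntegral_const, hvol, mul_comm]
      _ ≤ ∫⁻ y in C, (2 * ‖contRep u y‖ₑ ^ 2 + 2 * (L * D)) :=
          setLIntegral_mono' measurableSet_Ioc hpt
      _ = _ := by
        rw [lintegral_add_right' _ aemeasurable_const, setLIntegral_const, hvol,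
          lintegral_const_mul' _ _ (by norm_num), mul_comm L (2 * _)]
  calc ‖contRep u x‖ₑ ^ 2 = L⁻¹ * (L * ‖contRep u x‖ₑ ^ 2) := by
        rw [← mul_assoc, ENNReal.inv_mul_cancel hL0 hLt, one_mul]
    _ ≤ L⁻¹ * (2 * (∫⁻ y in C, ‖contRep u y‖ₑ ^ 2) + L * (2 * (L * D))) := by gcongr
    _ = 2 * L⁻¹ * (∫⁻ y in C, ‖contRep u y‖ₑ ^ 2) + 2 * L * D := by
        rw [mul_add, ← mul_assoc L⁻¹ L, ENNReal.inv_mul_cancel hL0 hLt, one_mul]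
        ring
    _ = _ := by
        rw [lintegral_add_left', lintegral_const_mul' _ _ (by finiteness),
          lintegral_const_mul' _ _ (by finiteness)]
        exact ((continuous_contRep u).aestronglyMeasurable.enorm.pow_const 2).const_mul _

/-- The form bound of a uniformly locally bounded local measure, on a union of cells of
length `ℓ ≤ 1`. -/
lemma setLIntegral_contRep_sq_variation_le (μ : LocalMeasure) (u : sobolev) {ℓ : ℝ}
    (h1 : ℓ ≤ 1) (J : Set ℤ) :
    ∫⁻ x in ⋃ k ∈ J, Ioc (k • ℓ) ((k + 1) • ℓ), ‖contRep u x‖ₑ ^ 2 ∂μ.variation ≤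
      μ.unifNorm * ∫⁻ y in ⋃ k ∈ J, Ioc (k • ℓ) ((k + 1) • ℓ),
        (2 * (ENNReal.ofReal ℓ)⁻¹ * ‖contRep u y‖ₑ ^ 2 +
          2 * ENNReal.ofReal ℓ * ‖weakDeriv u y‖ₑ ^ 2) := by
  have hm : ∀ k ∈ J, MeasurableSet (Ioc (k • ℓ) ((k + 1) • ℓ)) := fun _ _ => measurableSet_Ioc
  have hd : J.PairwiseDisjoint fun k : ℤ => Ioc (k • ℓ) ((k + 1) • ℓ) :=
    (pairwise_disjoint_Ioc_zsmul ℓ).set_pairwise J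
  have hlen : ∀ k : ℤ, (k + 1) • ℓ = k • ℓ + ℓ := fun k => by rw [add_smul, one_smul]
  rw [lintegral_biUnion J.to_countable hm hd, lintegral_biUnion J.to_countable hm hd,
    ← ENNReal.tsum_mul_left]
  refine ENNReal.tsum_le_tsum fun k => ?_
  have hpt := fun x hx => enorm_contRep_sq_le_setLIntegral u
    (a := (k : ℤ) • ℓ) (b := ((k : ℤ) + 1) • ℓ) (x := x) hx
  rw [show ((k : ℤ) + 1) • ℓ - (k : ℤ) • ℓ = ℓ by rw [hlen]; ring] at hpt
  refine (setLIntegral_mono' measurableSet_Ioc hpt).trans ?_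
  rw [setLIntegral_const, mul_comm]
  gcongr
  -- As `ℓ ≤ 1`, the cell lies in the unit cell with the same left endpoint, whose mass is at most
  -- `unifNorm`.
  refine (measure_mono (Ioc_subset_Ioc_right ?_)).trans
    (le_iSup (fun t : ℝ => μ.variation (Ioc t (t + 1))) ((k : ℤ) • ℓ))
  rw [hlen]; linarith

/-- The length `ℓ` is left free: a small `ℓ` makes the coefficient of `|u'|²` small, at the price of
a large one for `|u|²`. -/
lemma lintegral_contRep_sq_variation_le (μ : LocalMeasure) (u : sobolev) {ℓ : ℝ} (h0 : 0 < ℓ)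
    (h1 : ℓ ≤ 1) :
    ∫⁻ x, ‖contRep u x‖ₑ ^ 2 ∂μ.variation ≤
      μ.unifNorm * ∫⁻ y, (2 * (ENNReal.ofReal ℓ)⁻¹ * ‖contRep u y‖ₑ ^ 2 +
          2 * ENNReal.ofReal ℓ * ‖weakDeriv u y‖ₑ ^ 2) := by
  have h := setLIntegral_contRep_sq_variation_le μ u h1 univ
  simpa only [biUnion_univ, iUnion_Ioc_zsmul h0, Measure.restrict_univ] using h

lemma LocalMeasure.enorm_integral_le {E : Type*} [NormedAddCommGroup E] [NormedSpace ℝ E]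
    (μ : LocalMeasure) (f : ℝ → E) : ‖μ.integral f‖ₑ ≤ ∫⁻ x, ‖f x‖ₑ ∂μ.variation := by
  rw [LocalMeasure.variation, lintegral_add_measure]
  exact enorm_sub_le.trans (add_le_add (enorm_integral_le_lintegral_enorm _)
    (enorm_integral_le_lintegral_enorm _))

/-! ### Abstract operator theory -/

section Abstract
variable {E : Type*} [NormedAddCommGroup E] [InnerProductSpace ℂ E]

/-- The Lax-Milgram theorem over `ℂ`, for operators whose numerical range stays away from `0`. -/
lemma surjective_of_le_norm_inner [CompleteSpace E] (A : E →L[ℂ] E) {c : ℝ} (hc : 0 < c)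
    (h : ∀ u, c * ‖u‖ ^ 2 ≤ ‖inner ℂ (A u) u‖) : Function.Surjective A := by
  have hbelow : ∀ u, c * ‖u‖ ≤ ‖A u‖ := by
    intro u
    rcases eq_or_ne u 0 with rfl | hu
    · simp
    · have := (h u).trans (norm_inner_le_norm _ _)
      have hp := norm_pos_iff.2 hu
      nlinarith
  have hanti : AntilipschitzWith (c⁻¹.toNNReal) A := by
    refine A.antilipschitz_of_bound fun u => ?_
    rw [Real.coe_toNNReal _ (inv_pos.2 hc).le, ← div_eq_inv_mul, le_div_iff₀ hc, mul_comm]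
    exact hbelow u
  have hclosed : IsClosed (A.range : Set E) := hanti.isClosed_range A.uniformContinuous
  have := hclosed.completeSpace_coe
  refine (LinearMap.range_eq_top (f := (A : E →ₗ[ℂ] E))).1 ?_
  -- The range is closed, so it is everything once its orthogonal complement vanishes. A vector `w`
  -- in the complement satisfies `⟨A w, w⟩ = 0`, and the lower bound forces `w = 0`.
  rw [← A.range.orthogonal_orthogonal,
    Submodule.eq_top_iff']
  intro v w hw
  have hw0 : inner ℂ (A w) w = 0 := hw _ ⟨w, rfl⟩
  have h1 := h w
  rw [hw0, norm_zero] at h1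
  have h2 : ‖w‖ = 0 := by
    by_contra h3
    have := pow_pos (lt_of_le_of_ne (norm_nonneg w) (Ne.symm h3)) 2
    nlinarith
  rw [norm_eq_zero.1 h2, inner_zero_left]

/-- The Lax-Milgram theorem for a sesquilinear form on a vector space which is embedded onto a
closed subspace of a Hilbert space. -/
lemma exists_forall_sesquilinear_eq_inner [CompleteSpace E] {V : Type*} [AddCommGroup V]
    [Module ℂ V] {j : V →ₗ[ℂ] E} (hj : Function.Injective j) (hcl : IsClosed (j.range : Set E))
    (b : V →ₗ[ℂ] V →ₗ⋆[ℂ] ℂ) {C c : ℝ} (hC : ∀ u v, ‖b u v‖ ≤ C * ‖j u‖ * ‖j v‖) (hc : 0 < c)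
    (hb : ∀ u, c * ‖j u‖ ^ 2 ≤ ‖b u u‖) (F : E) : ∃ u, ∀ v, b u v = inner ℂ (j v) F := by
  have hcomp : CompleteSpace j.range := hcl.completeSpace_coe
  let e : V ≃ₗ[ℂ] j.range := LinearEquiv.ofInjective j hj
  have hje : ∀ w : j.range, j (e.symm w) = w := fun w =>
    congrArg Subtype.val (e.apply_symm_apply w)
  -- The inner product is conjugate-linear in its first argument, opposite to `b`; conjugating `b`
  -- makes the Riesz representation applicable.
  let b' : j.range →ₗ⋆[ℂ] j.range →ₗ[ℂ] ℂ := LinearMap.mk₂'ₛₗ (starRingEnd ℂ) (RingHom.id ℂ)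
    (fun v w => conj (b (e.symm v) (e.symm w)))
    (fun v v' w => by simp)
    (fun a v w => by simp)
    (fun v w w' => by simp)
    (fun a v w => by simp)
  have hb' : ∀ v w : j.range, ‖b' v w‖ ≤ C * ‖v‖ * ‖w‖ := by
    intro v w
    have h := hC (e.symm v) (e.symm w)
    rw [hje, hje] at h
    exact (RCLike.norm_conj _).trans_le h
  obtain ⟨A, hA⟩ : ∃ A : j.range →L[ℂ] j.range, ∀ v w, inner ℂ (A v) w = b' v w :=
    ⟨_, InnerProductSpace.continuousLinearMapOfBilin_apply (b'.mkContinuous₂ C hb')⟩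
  have hsurj : Function.Surjective A := by
    refine surjective_of_le_norm_inner A hc fun u => ?_
    have h := hb (e.symm u)
    rw [hje] at h
    rw [hA]
    exact h.trans_eq (RCLike.norm_conj _).symm
  -- The adjoint of the inclusion projects `F` onto the subspace without changing its pairings with
  -- the vectors `j v`.
  obtain ⟨w, hw⟩ := hsurj (j.range.subtypeL.adjoint F)
  refine ⟨e.symm w, fun v => ?_⟩
  have h1 : inner ℂ (A w) (e v) = conj (b (e.symm w) (e.symm (e v))) := hA w (e v)
  rw [hw, ContinuousLinearMap.adjoint_inner_left, e.symm_apply_apply] at h1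
  rw [← Complex.conj_conj (b _ _), ← h1, inner_conj_symm]
  rfl

lemma im_inner_apply_sub_smul {T : E →ₗ.[ℂ] E} (hT : T.IsFormalAdjoint T) (z : ℂ)
    (u : T.domain) : (inner ℂ (u : E) (T u - z • (u : E))).im = -(z.im * ‖(u : E)‖ ^ 2) := by
  have h0 : (inner ℂ (u : E) (T u)).im = 0 := by
    rw [← Complex.conj_eq_iff_im, inner_conj_symm, hT u u]
  have h1 : inner ℂ (u : E) (u : E) = ((‖(u : E)‖ ^ 2 : ℝ) : ℂ) := by
    rw [inner_self_eq_norm_sq_to_K]; norm_cast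
  rw [inner_sub_right, inner_smul_right, h1, Complex.sub_im, h0, Complex.im_mul_ofReal, zero_sub]

/-- Symmetry makes `⟨u, T u⟩` real, so the imaginary part of `⟨u, (T - z) u⟩` comes from `z` alone.
This bound gives both injectivity of `T - z` and the norm of its inverse. -/
lemma abs_im_mul_norm_le {T : E →ₗ.[ℂ] E} (hT : T.IsFormalAdjoint T) (z : ℂ) (u : T.domain) :
    |z.im| * ‖(u : E)‖ ≤ ‖T u - z • (u : E)‖ := by
  have h2 : |z.im| * ‖(u : E)‖ ^ 2 ≤ ‖(u : E)‖ * ‖T u - z • (u : E)‖ := by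
    refine le_trans ?_ (norm_inner_le_norm (𝕜 := ℂ) _ _)
    refine le_trans ?_ (Complex.abs_im_le_norm _)
    rw [im_inner_apply_sub_smul hT, abs_neg, abs_mul, abs_of_nonneg (sq_nonneg ‖(u : E)‖)]
  rcases (norm_nonneg (u : E)).eq_or_lt with h | h
  · rw [← h]; simp
  · nlinarith

lemma exists_isResolventAt {T : E →ₗ.[ℂ] E} (hT : T.IsFormalAdjoint T) {z : ℂ} (hz : z.im ≠ 0)
    (hs : ∀ f : E, ∃ u : T.domain, T u - z • (u : E) = f) :
    ∃ R : E →L[ℂ] E, IsResolventAt T z R := by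
  have hpos : 0 < |z.im| := abs_pos.2 hz
  have huniq : ∀ u w : T.domain, T u - z • (u : E) = T w - z • (w : E) → u = w := by
    intro u w h
    have h1 := abs_im_mul_norm_le hT z (u - w)
    have h2 : T (u - w) - z • ((u - w : T.domain) : E) = 0 := by
      rw [T.map_sub, Submodule.coe_sub, smul_sub, sub_sub_sub_comm, h, sub_self]
    rw [h2, norm_zero] at h1
    have h3 : ‖((u - w : T.domain) : E)‖ = 0 := by
      by_contra h4
      have := mul_pos hpos (lt_of_le_of_ne (norm_nonneg _) (Ne.symm h4))
      linarith
    exact sub_eq_zero.1 (Subtype.ext (norm_eq_zero.1 h3))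
  choose S hS using hs
  let R : E →ₗ[ℂ] E :=
    { toFun := fun f => S f
      map_add' := fun f g => by
        rw [← Submodule.coe_add]
        congr 1
        refine huniq _ _ ?_
        rw [hS, T.map_add, Submodule.coe_add, smul_add, add_sub_add_comm, hS, hS]
      map_smul' := fun c f => by
        rw [RingHom.id_apply, ← Submodule.coe_smul]
        congr 1
        refine huniq _ _ ?_
        rw [hS, T.map_smul, Submodule.coe_smul, smul_comm z c, ← smul_sub, hS] }
  refine ⟨R.mkContinuous |z.im|⁻¹ fun f => ?_, fun f => ⟨S f, rfl, hS f⟩, fun u => ?_⟩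
  · have := abs_im_mul_norm_le hT z (S f)
    rw [hS] at this
    rwa [← div_eq_inv_mul, le_div_iff₀ hpos, mul_comm]
  · exact congrArg Subtype.val (huniq _ _ (hS _))

/-- The range criterion at `±i`. Density of the domain is not assumed, since it also follows from
surjectivity. -/
lemma isSelfAdjoint_of_surjective [CompleteSpace E] {T : E →ₗ.[ℂ] E} (hT : T.IsFormalAdjoint T)
    (hs : ∀ z : ℂ, z.im ≠ 0 → ∀ f : E, ∃ u : T.domain, T u - z • (u : E) = f) :
    IsSelfAdjoint T := by
  have hI : Complex.I.im ≠ 0 := by simp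
  -- A vector orthogonal to the domain has the form `(T - i) u`. Pairing it with `u` and taking
  -- imaginary parts gives `‖u‖² = 0`.
  have hd : Dense (T.domain : Set E) := by
    rw [Submodule.dense_iff_topologicalClosure_eq_top, Submodule.topologicalClosure_eq_top_iff,
      Submodule.eq_bot_iff]
    intro w hw
    obtain ⟨u, rfl⟩ := hs Complex.I hI w
    have h1 := congrArg Complex.im (hw u u.2)
    rw [im_inner_apply_sub_smul hT] at h1
    have h2 : (u : E) = 0 := by simpa using h1
    have h3 : u = 0 := Subtype.ext h2
    rw [h3, T.map_zero]; simp
  rw [LinearPMap.isSelfAdjoint_def]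
  refine le_antisymm ?_ (hT.le_adjoint hd)
  refine LinearPMap.le_of_le_graph ?_
  rintro ⟨y, g⟩ hy
  obtain ⟨⟨y, hyd⟩, rfl, rfl⟩ := LinearPMap.mem_graph_iff _ |>.1 hy
  -- For `y` in the domain of the adjoint, solve `(T - i) u = (T* - i) y`. Then `y - u` is
  -- orthogonal to the range of `T + i`, which is the whole space, and so `y = u` lies in the domain
  -- of `T`.
  obtain ⟨u, hu⟩ := hs Complex.I hI (LinearPMap.adjoint T ⟨y, hyd⟩ - Complex.I • y)
  have key : y = u := by
    obtain ⟨x, hx⟩ := hs (-Complex.I) (by simp) (y - u)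
    have h1 := LinearPMap.adjoint_isFormalAdjoint hd ⟨y, hyd⟩ x
    have h2 := hT u x
    have h3 : inner ℂ (y - u) (T x - (-Complex.I) • (x : E)) = 0 := by
      have h4 := congrArg (fun t => inner ℂ t (x : E)) hu
      simp only [inner_sub_left, inner_smul_left, inner_sub_right, inner_smul_right] at h4 ⊢
      rw [h1, h2] at h4
      simp only [Complex.conj_I] at h4
      linear_combination -h4
    rw [hx, inner_self_eq_zero] at h3
    exact sub_eq_zero.1 h3
  subst key
  rw [LinearPMap.mem_graph_iff]
  exact ⟨u, rfl, by simpa using hu⟩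

end Abstract

/-! ### The Sobolev space as a Hilbert space -/

/-- The embedding `u ↦ (u, u')` of `W_2^1(ℝ)`, whose norm is the Sobolev norm. -/
noncomputable def jet : sobolev →ₗ[ℂ] WithLp 2 (L2 × L2) where
  toFun u := WithLp.toLp 2 ((u : L2), weakDeriv u)
  map_add' u v := by rw [weakDeriv_add]; rfl
  map_smul' c u := by rw [weakDeriv_smul]; rfl

lemma jet_injective : Function.Injective jet := fun _ _ h =>
  Subtype.ext (congrArg (fun p : WithLp 2 (L2 × L2) => p.fst) h)

lemma norm_jet_sq (u : sobolev) : ‖jet u‖ ^ 2 = ‖(u : L2)‖ ^ 2 + ‖weakDeriv u‖ ^ 2 :=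
  WithLp.prod_norm_sq_eq_of_L2 _

lemma norm_coe_le_norm_jet (u : sobolev) : ‖(u : L2)‖ ≤ ‖jet u‖ := by
  refine (sq_le_sq₀ (norm_nonneg _) (norm_nonneg _)).1 ?_
  rw [norm_jet_sq]
  exact le_add_of_nonneg_right (sq_nonneg _)

lemma norm_weakDeriv_le_norm_jet (u : sobolev) : ‖weakDeriv u‖ ≤ ‖jet u‖ := by
  refine (sq_le_sq₀ (norm_nonneg _) (norm_nonneg _)).1 ?_
  rw [norm_jet_sq]
  exact le_add_of_nonneg_left (sq_nonneg _)

/-- This is the completeness of `W_2^1`; the type `sobolev` itself only inherits the `L_2` norm, for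
which it is not complete. For each test function, the defining identity of the weak derivative
equates two continuous functions of the pair, hence is a closed condition. -/
lemma isClosed_range_jet : IsClosed (jet.range : Set (WithLp 2 (L2 × L2))) := by
  have hrange : (jet.range : Set (WithLp 2 (L2 × L2))) =
      {p | HasWeakDeriv (p.fst : ℝ → ℂ) (p.snd : ℝ → ℂ)} := by
    ext p
    constructor
    · rintro ⟨u, rfl⟩
      exact hasWeakDeriv_weakDeriv u
    · intro hp
      refine ⟨⟨p.fst, p.snd, hp⟩, ?_⟩
      have : weakDeriv ⟨p.fst, p.snd, hp⟩ = p.snd := weakDeriv_eq hp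
      exact congrArg (fun g => WithLp.toLp 2 (p.fst, g)) this
  have hpair : ∀ φ : ℝ → ℝ, Continuous φ → HasCompactSupport φ →
      Continuous fun f : L2 => ∫ x, φ x • f x := by
    intro φ h1 h2
    have m : MemLp (fun x => (φ x : ℂ)) 2 volume :=
      (Complex.continuous_ofReal.comp h1).memLp_of_hasCompactSupport
        (h2.comp_left (g := fun r : ℝ => (r : ℂ)) Complex.ofReal_zero)
    have e : (fun f : L2 => ∫ x, φ x • f x) = fun f => inner ℂ m.toLp f := by
      funext f
      rw [L2.inner_def]
      refine integral_congr_ae ?_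
      filter_upwards [m.coeFn_toLp] with x hx
      rw [hx]
      simp [mul_comm]
    rw [e]
    fun_prop
  rw [hrange]
  simp only [HasWeakDeriv, ofPred_forall]
  refine isClosed_iInter fun φ => isClosed_iInter fun hφ => isClosed_iInter fun hc => ?_
  refine isClosed_eq ?_ ?_
  · exact (hpair _ (contDiff_infty_iff_deriv.1 hφ).2.continuous hc.deriv).comp
      (WithLp.prod_continuous_ofLp 2 L2 L2).fst
  · exact ((hpair _ hφ.continuous hc).comp (WithLp.prod_continuous_ofLp 2 L2 L2).snd).neg

lemma enorm_L2_sq (f : L2) : ‖f‖ₑ ^ 2 = ∫⁻ x, ‖f x‖ₑ ^ 2 := by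
  have e := eLpNorm_nnreal_pow_eq_lintegral (f := (f : ℝ → ℂ)) (μ := volume) (p := 2)
    (by norm_num)
  norm_num at e
  rw [Lp.enorm_def, e]

lemma lintegral_contRep_sq (u : sobolev) : ∫⁻ x, ‖contRep u x‖ₑ ^ 2 = ‖(u : L2)‖ₑ ^ 2 := by
  rw [enorm_L2_sq]
  refine lintegral_congr_ae ?_
  filter_upwards [coe_ae_eq_contRep u] with x hx
  rw [hx]

/-! ### Bounds for the form -/

lemma lintegral_contRep_sq_variation_le_ofReal (μ : LocalMeasure) {K : ℝ≥0} (hK : μ.unifNorm ≤ K)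
    (u : sobolev) {ℓ : ℝ} (h0 : 0 < ℓ) (h1 : ℓ ≤ 1) :
    ∫⁻ x, ‖contRep u x‖ₑ ^ 2 ∂μ.variation ≤
      ENNReal.ofReal (K * (2 / ℓ * ‖(u : L2)‖ ^ 2 + 2 * ℓ * ‖weakDeriv u‖ ^ 2)) := by
  refine (lintegral_contRep_sq_variation_le μ u h0 h1).trans ?_
  have hℓ : ENNReal.ofReal ℓ ≠ 0 := (ENNReal.ofReal_pos.2 h0).ne'
  rw [lintegral_add_left', lintegral_const_mul' _ _ (by finiteness),
    lintegral_const_mul' _ _ (by finiteness), lintegral_contRep_sq, ← enorm_L2_sq,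
    ENNReal.ofReal_mul (by positivity), ENNReal.ofReal_add (by positivity) (by positivity),
    ENNReal.ofReal_mul (by positivity), ENNReal.ofReal_mul (p := 2 * ℓ) (by positivity),
    ENNReal.ofReal_mul (p := 2) (by positivity), ENNReal.ofReal_pow (norm_nonneg _),
    ENNReal.ofReal_pow (norm_nonneg _), ofReal_norm, ofReal_norm, ENNReal.ofReal_div_of_pos h0,
    ENNReal.ofReal_coe_nnreal, div_eq_mul_inv]
  · norm_num
    gcongr
  · exact ((continuous_contRep u).aestronglyMeasurable.enorm.pow_const 2).const_mul _

lemma norm_integral_contRep_self_le (μ : LocalMeasure) {K : ℝ≥0} (hK : μ.unifNorm ≤ K)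
    (u : sobolev) {ℓ : ℝ} (h0 : 0 < ℓ) (h1 : ℓ ≤ 1) :
    ‖μ.integral fun x => contRep u x * conj (contRep u x)‖ ≤
      K * (2 / ℓ * ‖(u : L2)‖ ^ 2 + 2 * ℓ * ‖weakDeriv u‖ ^ 2) := by
  rw [← ENNReal.ofReal_le_ofReal_iff (by positivity), ofReal_norm]
  refine (μ.enorm_integral_le _).trans ?_
  refine le_trans (le_of_eq ?_) (lintegral_contRep_sq_variation_le_ofReal μ hK u h0 h1)
  refine lintegral_congr fun x => ?_
  rw [enorm_mul, RCLike.enorm_conj, sq]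

lemma lintegral_contRep_sq_variation_le_jet (μ : LocalMeasure) {K : ℝ≥0} (hK : μ.unifNorm ≤ K)
    (u : sobolev) :
    ∫⁻ x, ‖contRep u x‖ₑ ^ 2 ∂μ.variation ≤ ENNReal.ofReal (2 * K * ‖jet u‖ ^ 2) := by
  refine (lintegral_contRep_sq_variation_le_ofReal μ hK u one_pos le_rfl).trans_eq ?_
  rw [norm_jet_sq]
  ring_nf

/-- On a Borel set `S`, the form of a local measure is controlled by the mass of `u` on `S`. -/
lemma setLIntegral_contRep_mul_sq_le (μ : LocalMeasure) {K : ℝ≥0} (hK : μ.unifNorm ≤ K)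
    (u v : sobolev) (S : Set ℝ) :
    (∫⁻ x in S, ‖contRep u x‖ₑ * ‖contRep v x‖ₑ ∂μ.variation) ^ 2 ≤
      (∫⁻ x in S, ‖contRep u x‖ₑ ^ 2 ∂μ.variation) * ENNReal.ofReal (2 * K * ‖jet v‖ ^ 2) := by
  refine (lintegral_mul_sq_le (continuous_contRep u).aestronglyMeasurable.enorm
    (continuous_contRep v).aestronglyMeasurable.enorm).trans ?_
  gcongr
  exact (setLIntegral_le_lintegral _ _).trans (lintegral_contRep_sq_variation_le_jet μ hK v)

lemma norm_integral_contRep_mul_le (μ : LocalMeasure) {K : ℝ≥0} (hK : μ.unifNorm ≤ K)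
    (u v : sobolev) :
    ‖μ.integral fun x => contRep u x * conj (contRep v x)‖ ≤ 2 * K * (‖jet u‖ * ‖jet v‖) := by
  have h := setLIntegral_contRep_mul_sq_le μ hK u v univ
  rw [Measure.restrict_univ] at h
  have h1 := μ.enorm_integral_le fun x => contRep u x * conj (contRep v x)
  simp only [enorm_mul, RCLike.enorm_conj] at h1
  have h2 := (pow_le_pow_left₀ zero_le h1 2).trans (h.trans
    (mul_le_mul_left (lintegral_contRep_sq_variation_le_jet μ hK u) _))
  rw [← ofReal_norm, ← ENNReal.ofReal_pow (norm_nonneg _), ← ENNReal.ofReal_mul (by positivity),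
    ENNReal.ofReal_le_ofReal_iff (by positivity)] at h2
  refine (sq_le_sq₀ (norm_nonneg _) (by positivity)).1 ?_
  linarith

lemma form_conj_symm (μ : ULBMeasure) (u v : sobolev) : conj (form μ u v) = form μ v u := by
  simp only [form, LocalMeasure.integral, map_add, map_sub, ← integral_conj, map_mul,
    Complex.conj_conj, mul_comm]

lemma form_add_right (μ : ULBMeasure) (u v v' : sobolev) :
    form μ u (v + v') = form μ u v + form μ u v' := by
  rw [← form_conj_symm, form_add_left, map_add, form_conj_symm, form_conj_symm]

lemma form_smul_right (μ : ULBMeasure) (c : ℂ) (u v : sobolev) :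
    form μ u (c • v) = conj c * form μ u v := by
  rw [← form_conj_symm, form_smul_left, map_mul, form_conj_symm]

lemma integral_weakDeriv_mul (u v : sobolev) :
    ∫ x, weakDeriv u x * conj (weakDeriv v x) = inner ℂ (weakDeriv v) (weakDeriv u) := by
  rw [L2.inner_def]
  rfl

lemma norm_form_le (μ : ULBMeasure) {K : ℝ≥0} (hK : μ.1.unifNorm ≤ K) (u v : sobolev) :
    ‖form μ u v‖ ≤ (1 + 2 * K) * (‖jet u‖ * ‖jet v‖) := by
  rw [form, integral_weakDeriv_mul, add_mul, one_mul]
  refine (norm_add_le _ _).trans (add_le_add ?_ (norm_integral_contRep_mul_le _ hK u v))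
  rw [mul_comm]
  exact (norm_inner_le_norm _ _).trans (mul_le_mul (norm_weakDeriv_le_norm_jet v)
    (norm_weakDeriv_le_norm_jet u) (norm_nonneg _) (norm_nonneg _))

/-- Away from the real axis the shifted forms are coercive, uniformly for a bounded family of
measures. -/
lemma exists_coercive (K : ℝ≥0) {z : ℂ} (hz : z.im ≠ 0) : ∃ c : ℝ, 0 < c ∧
    ∀ μ : ULBMeasure, μ.1.unifNorm ≤ K → ∀ u : sobolev,
      c * ‖jet u‖ ^ 2 ≤ ‖form μ u u - z * inner ℂ (u : L2) (u : L2)‖ := by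
  have hpos : 0 < |z.im| := abs_pos.2 hz
  -- With this `ℓ` the potential costs at most half of `‖u'‖²`, as `2 * K * ℓ ≤ 1 / 2`. The summand
  -- `1` ensures `ℓ ≤ 1` and covers `K = 0`.
  set ℓ : ℝ := 1 / (4 * K + 1) with hℓ
  have hℓ0 : 0 < ℓ := by positivity
  have hKℓ : 4 * K * ℓ ≤ 1 := by
    rw [hℓ, mul_one_div, div_le_one (by positivity)]; linarith
  have hℓ1 : ℓ ≤ 1 := by
    rw [hℓ, div_le_one (by positivity)]; linarith [K.2]
  set γ : ℝ := K * (2 / ℓ) with hγ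
  have hγ0 : 0 ≤ γ := by positivity
  -- `M` results from adding `h3` and `h5` below: the imaginary part of `B` controls `‖u‖²`, and
  -- then its real part controls `‖u'‖²`.
  set M : ℝ := 2 + (2 * (|z.re| + γ) + 1) / |z.im| with hM
  have hM0 : 0 < M := by positivity
  refine ⟨M⁻¹, inv_pos.2 hM0, fun μ hK u => ?_⟩
  rw [← div_eq_inv_mul, div_le_iff₀ hM0, norm_jet_sq]
  set n := ‖(u : L2)‖ ^ 2 with hn
  set d := ‖weakDeriv u‖ ^ 2 with hd
  have hn0 : 0 ≤ n := by positivity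
  have hd0 : 0 ≤ d := by positivity
  set m := μ.1.integral fun x => contRep u x * conj (contRep u x) with hm
  have hmle := norm_integral_contRep_self_le μ.1 hK u hℓ0 hℓ1
  have hself : ∀ f : L2, inner ℂ f f = ((‖f‖ ^ 2 : ℝ) : ℂ) := fun f => by
    rw [inner_self_eq_norm_sq_to_K]; norm_cast
  have hre := (abs_le.1 (Complex.abs_re_le_norm m)).1
  have him : (form μ u u).im = 0 := by
    rw [← Complex.conj_eq_iff_im, form_conj_symm]
  set B := form μ u u - z * inner ℂ (u : L2) (u : L2) with hB
  have hBim : B.im = -(z.im * n) := by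
    rw [hB, hself, Complex.sub_im, him, Complex.im_mul_ofReal, zero_sub]
  have hBre : B.re = d + m.re - z.re * n := by
    rw [hB, hself, Complex.sub_re, Complex.re_mul_ofReal, form, integral_weakDeriv_mul, hself,
      Complex.add_re, Complex.ofReal_re]
  have h1 : |z.im| * n ≤ ‖B‖ := by
    refine le_trans (le_of_eq ?_) (Complex.abs_im_le_norm B)
    rw [hBim, abs_neg, abs_mul, abs_of_nonneg hn0]
  have h2 : d + m.re - z.re * n ≤ ‖B‖ := hBre ▸ (le_abs_self _).trans (Complex.abs_re_le_norm B)
  have h3 : n ≤ ‖B‖ / |z.im| := by rwa [le_div_iff₀ hpos, mul_comm]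
  have h4 : z.re * n ≤ |z.re| * n := by gcongr; exact le_abs_self _
  have h5 : d ≤ 2 * ‖B‖ + 2 * (|z.re| + γ) * n := by
    have : ‖m‖ ≤ γ * n + d / 2 := by
      refine hmle.trans ?_
      have := mul_le_mul_of_nonneg_right hKℓ hd0
      rw [hγ]; linarith
    linarith
  have h6 := mul_le_mul_of_nonneg_left h3 (show 0 ≤ 2 * (|z.re| + γ) + 1 by positivity)
  have h7 : ‖B‖ * M = 2 * ‖B‖ + (2 * (|z.re| + γ) + 1) * (‖B‖ / |z.im|) := by
    rw [hM]; ring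
  linarith

/-! ### Self-adjointness -/

lemma exists_form_sub_eq_inner (μ : ULBMeasure) {z : ℂ} (hz : z.im ≠ 0) (f : L2) :
    ∃ u : sobolev, ∀ v : sobolev,
      form μ u v - z * inner ℂ (v : L2) (u : L2) = inner ℂ (v : L2) f := by
  lift μ.1.unifNorm to ℝ≥0 using μ.2.ne with K hK
  obtain ⟨c, hc, hcoer⟩ := exists_coercive K hz
  let b : sobolev →ₗ[ℂ] sobolev →ₗ⋆[ℂ] ℂ := LinearMap.mk₂'ₛₗ (RingHom.id ℂ) (starRingEnd ℂ)
    (fun u v => form μ u v - z * inner ℂ (v : L2) (u : L2))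
    (fun u u' v => by
      rw [form_add_left, Submodule.coe_add, inner_add_right]
      ring)
    (fun a u v => by
      rw [form_smul_left, Submodule.coe_smul, inner_smul_right, RingHom.id_apply, smul_eq_mul]
      ring)
    (fun u v v' => by
      rw [form_add_right, Submodule.coe_add, inner_add_left]
      ring)
    (fun a u v => by
      rw [form_smul_right, Submodule.coe_smul, inner_smul_left, smul_eq_mul]
      ring)
  have hb : ∀ u v : sobolev, ‖b u v‖ ≤ (1 + 2 * K + ‖z‖) * ‖jet u‖ * ‖jet v‖ := by
    intro u v
    change ‖form μ u v - z * inner ℂ (v : L2) (u : L2)‖ ≤ _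
    rw [mul_assoc, add_mul]
    refine (norm_sub_le _ _).trans (add_le_add (norm_form_le μ hK.ge _ _) ?_)
    rw [norm_mul, mul_comm ‖jet _‖]
    gcongr
    exact (norm_inner_le_norm _ _).trans (mul_le_mul (norm_coe_le_norm_jet _)
      (norm_coe_le_norm_jet _) (norm_nonneg _) (norm_nonneg _))
  -- The functional `v ↦ ⟨f, v⟩` is represented by `(f, 0)`, since its second component ignores
  -- `v'`.
  obtain ⟨u, hu⟩ := exists_forall_sesquilinear_eq_inner jet_injective isClosed_range_jet b hb hc
    (hcoer μ hK.ge) (WithLp.toLp 2 (f, 0))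
  refine ⟨u, fun v => (hu v).trans ?_⟩
  rw [WithLp.prod_inner_apply]
  simp [jet]

lemma mem_graph_schrodinger (μ : ULBMeasure) (x : (schrodinger μ).domain) :
    ∃ u : sobolev, (u : L2) = x ∧ ∀ v : sobolev, inner ℂ (v : L2) (schrodinger μ x) = form μ u v := by
  have h := (schrodinger μ).mem_graph x
  rw [graph_schrodinger] at h
  exact h

lemma isFormalAdjoint_schrodinger (μ : ULBMeasure) :
    (schrodinger μ).IsFormalAdjoint (schrodinger μ) := by
  intro x y
  obtain ⟨u, hu, hu'⟩ := mem_graph_schrodinger μ x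
  obtain ⟨v, hv, hv'⟩ := mem_graph_schrodinger μ y
  rw [← hu, ← hv, hv', ← inner_conj_symm, hu', form_conj_symm]

lemma exists_schrodinger_sub_eq (μ : ULBMeasure) {z : ℂ} (hz : z.im ≠ 0) (f : L2) :
    ∃ u : (schrodinger μ).domain, schrodinger μ u - z • (u : L2) = f := by
  obtain ⟨u, hu⟩ := exists_form_sub_eq_inner μ hz f
  have h : ((u : L2), f + z • (u : L2)) ∈ (schrodinger μ).graph := by
    rw [graph_schrodinger]
    refine ⟨u, rfl, fun v => ?_⟩
    rw [inner_add_right, inner_smul_right, ← hu, sub_add_cancel]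
  obtain ⟨y, hy, hy'⟩ := (LinearPMap.mem_graph_iff _).1 h
  exact ⟨y, by rw [hy', hy, add_sub_cancel_right]⟩

lemma isSelfAdjoint_schrodinger (μ : ULBMeasure) : IsSelfAdjoint (schrodinger μ) :=
  isSelfAdjoint_of_surjective (isFormalAdjoint_schrodinger μ) fun _ hz =>
    exists_schrodinger_sub_eq μ hz

lemma exists_resolvent_schrodinger (μ : ULBMeasure) {z : ℂ} (hz : z.im ≠ 0) :
    ∃ R : L2 →L[ℂ] L2, IsResolventAt (schrodinger μ) z R :=
  exists_isResolventAt (isFormalAdjoint_schrodinger μ) hz (exists_schrodinger_sub_eq μ hz)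

/-- The weak formulation of the resolvent equation. -/
lemma IsResolventAt.exists_form_sub_eq_inner {μ : ULBMeasure} {z : ℂ} {R : L2 →L[ℂ] L2}
    (hR : IsResolventAt (schrodinger μ) z R) (f : L2) : ∃ u : sobolev, (u : L2) = R f ∧
      ∀ v : sobolev, form μ u v - z * inner ℂ (v : L2) (u : L2) = inner ℂ (v : L2) f := by
  obtain ⟨x, hx, hx'⟩ := hR.1 f
  obtain ⟨u, hu, hu'⟩ := mem_graph_schrodinger μ x
  refine ⟨u, hu.trans hx, fun v => ?_⟩
  rw [← hx', inner_sub_right, inner_smul_right, hu', hu]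

/-! ### Calculus of integrals against local measures -/

namespace LocalMeasure

section
variable {E : Type*} [NormedAddCommGroup E] [NormedSpace ℝ E] {μ : LocalMeasure} {f g : ℝ → E}

lemma integral_add (hf : Integrable f μ.variation) (hg : Integrable g μ.variation) :
    μ.integral (fun x => f x + g x) = μ.integral f + μ.integral g := by
  have hf := integrable_add_measure.1 hf
  have hg := integrable_add_measure.1 hg
  rw [integral, integral, integral, MeasureTheory.integral_add hf.1 hg.1,
    MeasureTheory.integral_add hf.2 hg.2]
  abel

lemma integral_finset_sum {ι : Type*} (s : Finset ι) {F : ι → ℝ → E}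
    (hF : ∀ i ∈ s, Integrable (F i) μ.variation) :
    μ.integral (fun x => ∑ i ∈ s, F i x) = ∑ i ∈ s, μ.integral (F i) := by
  simp only [integral]
  rw [MeasureTheory.integral_finsetSum _ fun i hi => (integrable_add_measure.1 (hF i hi)).1,
    MeasureTheory.integral_finsetSum _ fun i hi => (integrable_add_measure.1 (hF i hi)).2,
    Finset.sum_sub_distrib]

lemma integral_const_mul (c : ℂ) (h : ℝ → ℂ) :
    μ.integral (fun x => c * h x) = c * μ.integral h := by
  simp only [integral, MeasureTheory.integral_const_mul, mul_sub]

end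

lemma variation_Ioc_le (μ : LocalMeasure) (N : ℕ) :
    μ.variation (Ioc (-N : ℝ) N) ≤ (2 * N : ℕ) * μ.unifNorm := by
  have hsub : Ioc (-N : ℝ) N ⊆ ⋃ i ∈ Finset.range (2 * N), Ioc (-N + i : ℝ) (-N + i + 1) := by
    intro x hx
    have h0 : 0 < x + N := by linarith [hx.1]
    -- The cells are open on the left, so the index of the cell containing `x` is the ceiling of `x
    -- + N` minus one, not the floor.
    obtain ⟨i, hi⟩ : ∃ i : ℕ, ⌈x + N⌉₊ = i + 1 :=
      Nat.exists_eq_succ_of_ne_zero (Nat.ceil_pos.2 h0).ne'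
    have h1 := (Nat.ceil_eq_iff (Nat.succ_ne_zero i)).1 hi
    have h2 : ⌈x + N⌉₊ ≤ 2 * N := Nat.ceil_le.2 (by push_cast; linarith [hx.2])
    simp only [Nat.succ_sub_one, Nat.succ_eq_add_one, Nat.cast_add, Nat.cast_one] at h1
    refine mem_biUnion (x := i) (Finset.mem_coe.2 (Finset.mem_range.2 (by omega))) ⟨?_, ?_⟩
    · linarith [h1.1]
    · linarith [h1.2]
  refine (measure_mono hsub).trans ((measure_biUnion_finset_le _ _).trans ?_)
  refine (Finset.sum_le_card_nsmul _ _ μ.unifNorm fun i _ =>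
    le_iSup (fun t : ℝ => μ.variation (Ioc t (t + 1))) (-N + (i : ℕ) : ℝ)).trans_eq ?_
  rw [Finset.card_range, nsmul_eq_mul]

end LocalMeasure

lemma isFiniteMeasureOnCompacts_variation (μ : ULBMeasure) :
    IsFiniteMeasureOnCompacts μ.1.variation := by
  refine ⟨fun S hS => ?_⟩
  obtain ⟨r, hr⟩ := hS.isBounded.subset_closedBall 0
  obtain ⟨N, hN⟩ := exists_nat_gt r
  have hsub : S ⊆ Ioc (-N : ℝ) N := fun x hx => by
    have := abs_le.1 (by simpa using hr hx : |x| ≤ r)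
    exact ⟨by linarith, by linarith⟩
  exact (measure_mono hsub).trans_lt ((μ.1.variation_Ioc_le N).trans_lt
    (ENNReal.mul_lt_top (ENNReal.natCast_lt_top _) μ.2))

lemma integrable_variation (μ : ULBMeasure) {E : Type*} [NormedAddCommGroup E] {f : ℝ → E}
    (hf : Continuous f) (hc : HasCompactSupport f) : Integrable f μ.1.variation := by
  have := isFiniteMeasureOnCompacts_variation μ
  exact hf.integrable_of_hasCompactSupport hc

lemma LocalMeasure.VagueTendsto.tendsto_complex {μs : ℕ → ULBMeasure} {μ : ULBMeasure}
    (h : LocalMeasure.VagueTendsto (fun n => (μs n).1) μ.1) {f : ℝ → ℂ} (hf : Continuous f)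
    (hc : HasCompactSupport f) :
    Tendsto (fun n => (μs n).1.integral f) atTop (𝓝 (μ.1.integral f)) := by
  have e : ∀ ν : ULBMeasure, ν.1.integral f =
      (ν.1.integral fun x => (f x).re : ℝ) + (ν.1.integral fun x => (f x).im : ℝ) * Complex.I := by
    intro ν
    have hi := integrable_add_measure.1 (integrable_variation ν hf hc)
    have h1 := integral_re_add_im hi.1
    have h2 := integral_re_add_im hi.2
    simp only [LocalMeasure.integral]
    rw [← h1, ← h2]
    push_cast
    simp only [RCLike.re_to_complex, RCLike.im_to_complex, RCLike.I_to_complex,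
      RCLike.ofReal_alg, Complex.real_smul, mul_one]
    ring
  rw [e μ]
  simp only [e]
  exact ((Complex.continuous_ofReal.tendsto _).comp (h _ (Complex.continuous_re.comp hf)
    (hc.comp_left (g := Complex.re) Complex.zero_re))).add
    (((Complex.continuous_ofReal.tendsto _).comp (h _ (Complex.continuous_im.comp hf)
    (hc.comp_left (g := Complex.im) Complex.zero_im))).mul_const _)

/-! ### Pointwise bounds by the Sobolev norm -/

/-- Equicontinuity of bounded subsets of `W_2^1`. It allows `v` to be replaced by its values at
finitely many points, with an error uniform in `v`. -/
lemma norm_contRep_sub_le (v : sobolev) {x y δ : ℝ} (hδ : 0 ≤ δ) (hxy : |x - y| ≤ δ) :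
    ‖contRep v x - contRep v y‖ ≤ √δ * ‖jet v‖ := by
  have h1 := enorm_contRep_sub_sq_le_setLIntegral v (x := x) (y := y) (a := min x y)
    (b := max x y) ⟨min_le_left _ _, le_max_left _ _⟩ ⟨min_le_right _ _, le_max_right _ _⟩
  have h2 := h1.trans (mul_le_mul_right (setLIntegral_le_lintegral _ _) _)
  rw [← enorm_L2_sq, max_sub_min_eq_abs, ← ofReal_norm, ← ofReal_norm,
    ← ENNReal.ofReal_pow (norm_nonneg _), ← ENNReal.ofReal_pow (norm_nonneg _),
    ← ENNReal.ofReal_mul (abs_nonneg _), ENNReal.ofReal_le_ofReal_iff (by positivity)] at h2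
  refine (sq_le_sq₀ (norm_nonneg _) (by positivity)).1 ?_
  rw [mul_pow, Real.sq_sqrt hδ]
  refine h2.trans (mul_le_mul (by rwa [abs_sub_comm]) ?_ (by positivity) hδ)
  exact pow_le_pow_left₀ (norm_nonneg _) (norm_weakDeriv_le_norm_jet v) 2

lemma norm_contRep_le (v : sobolev) (x : ℝ) : ‖contRep v x‖ ≤ 2 * ‖jet v‖ := by
  have h1 := enorm_contRep_sq_le_setLIntegral v (x := x) (a := x - 1) (b := x)
    ⟨by linarith, le_rfl⟩
  have h2 := h1.trans (setLIntegral_le_lintegral _ _)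
  simp only [sub_sub_cancel, ENNReal.ofReal_one, inv_one, mul_one] at h2
  rw [lintegral_add_left', lintegral_const_mul' _ _ (by finiteness),
    lintegral_const_mul' _ _ (by finiteness), lintegral_contRep_sq, ← enorm_L2_sq, ← mul_add,
    ← ofReal_norm, ← ofReal_norm, ← ofReal_norm, ← ENNReal.ofReal_pow (norm_nonneg _),
    ← ENNReal.ofReal_pow (norm_nonneg _), ← ENNReal.ofReal_pow (norm_nonneg _),
    ← ENNReal.ofReal_add (by positivity) (by positivity), ← norm_jet_sq,
    show (2 : ℝ≥0∞) * ENNReal.ofReal (‖jet v‖ ^ 2) =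
      ENNReal.ofReal 2 * ENNReal.ofReal (‖jet v‖ ^ 2) by rw [ENNReal.ofReal_ofNat], ← ENNReal.ofReal_mul (by positivity),
    ENNReal.ofReal_le_ofReal_iff (by positivity)] at h2
  · refine (sq_le_sq₀ (norm_nonneg _) (by positivity)).1 ?_
    nlinarith [sq_nonneg ‖jet v‖]
  · exact ((continuous_contRep v).aestronglyMeasurable.enorm.pow_const 2).const_mul _

/-! ### Uniform convergence of the forms -/

/-- The potential part of the form is small near infinity, uniformly for a bounded family of
measures. -/
lemma exists_cutoff (K : ℝ≥0) (u : sobolev) {ε : ℝ} (hε : 0 < ε) :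
    ∃ χ : ℝ → ℝ, Continuous χ ∧ HasCompactSupport χ ∧
      ∀ μ : LocalMeasure, μ.unifNorm ≤ K → ∀ v : sobolev,
        ‖μ.integral fun x => (1 - χ x : ℝ) * (contRep u x * conj (contRep v x))‖ ≤
          ε * ‖jet v‖ := by
  -- The integrand of the form bound for `ℓ = 1`. It depends on `u` only, so a cutoff chosen through
  -- it serves all measures and all `v`.
  set h : ℝ → ℝ≥0∞ := fun y => 2 * (ENNReal.ofReal 1)⁻¹ * ‖contRep u y‖ₑ ^ 2 +
    2 * ENNReal.ofReal 1 * ‖weakDeriv u y‖ₑ ^ 2 with hh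
  have hfin : ∫⁻ y, h y ≠ ⊤ := by
    rw [hh, lintegral_add_left', lintegral_const_mul' _ _ (by finiteness),
      lintegral_const_mul' _ _ (by finiteness), lintegral_contRep_sq, ← enorm_L2_sq]
    · finiteness
    · exact ((continuous_contRep u).aestronglyMeasurable.enorm.pow_const 2).const_mul _
  have hcell : ∀ J : Set ℤ, ∫⁻ y in ⋃ k ∈ J, Ioc (k • (1 : ℝ)) ((k + 1) • 1), h y =
      ∑' k : J, ∫⁻ y in Ioc ((k : ℤ) • (1 : ℝ)) (((k : ℤ) + 1) • 1), h y := fun J =>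
    lintegral_biUnion J.to_countable (fun _ _ => measurableSet_Ioc)
      ((pairwise_disjoint_Ioc_zsmul (1 : ℝ)).set_pairwise J) h
  have hsum : ∑' k : ℤ, ∫⁻ y in Ioc (k • (1 : ℝ)) ((k + 1) • 1), h y ≠ ⊤ := by
    rw [← lintegral_iUnion (fun _ => measurableSet_Ioc) (pairwise_disjoint_Ioc_zsmul (1 : ℝ)),
      iUnion_Ioc_zsmul one_pos, Measure.restrict_univ]
    exact hfin
  -- Cauchy-Schwarz will bound the squared tail by `K * η * (2 * K * ‖jet v‖ ^ 2)`, which must not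
  -- exceed `ε ^ 2 * ‖jet v‖ ^ 2`.
  set η : ℝ := ε ^ 2 / (2 * K ^ 2 + 1) with hη
  have hη0 : 0 < η := by positivity
  obtain ⟨s, hs⟩ := ((ENNReal.tendsto_tsum_compl_atTop_zero hsum).eventually_lt_const
    (ENNReal.ofReal_pos.2 hη0)).exists
  set S : Set ℝ := ⋃ k ∈ (sᶜ : Set ℤ), Ioc (k • (1 : ℝ)) ((k + 1) • 1) with hS
  have hSint : ∫⁻ y in S, h y ≤ ENNReal.ofReal η := (hcell _).trans_le hs.le
  have hbdd : Bornology.IsBounded (⋃ k ∈ s, Ioc (k • (1 : ℝ)) ((k + 1) • 1)) :=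
    (Bornology.isBounded_biUnion_finset s).2 fun _ _ => Metric.isBounded_Ioc _ _
  obtain ⟨r, hr0, hr⟩ := hbdd.subset_closedBall_lt 0 0
  let χ : ContDiffBump (0 : ℝ) := ⟨r, r + 1, hr0, by linarith⟩
  -- Off `S` lie only the finitely many cells indexed by `s`, all inside the ball where `χ = 1`.
  -- Thus `1 - χ` lives on `S`, where `u` has little mass.
  have hχ : ∀ x ∉ S, χ x = 1 := by
    intro x hx
    refine χ.one_of_mem_closedBall (hr ?_)
    have : x ∈ ⋃ k : ℤ, Ioc (k • (1 : ℝ)) ((k + 1) • 1) := by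
      rw [iUnion_Ioc_zsmul one_pos]; trivial
    obtain ⟨k, hk⟩ := mem_iUnion.1 this
    refine mem_biUnion (x := k) ?_ hk
    by_contra hks
    exact hx (mem_biUnion (x := k) hks hk)
  refine ⟨χ, χ.continuous, χ.hasCompactSupport, fun μ hK v => ?_⟩
  have hSm : MeasurableSet S :=
    MeasurableSet.biUnion (to_countable _) fun _ _ => measurableSet_Ioc
  have hbound : ‖μ.integral fun x => (1 - χ x : ℝ) * (contRep u x * conj (contRep v x))‖ₑ ≤
      ∫⁻ x in S, ‖contRep u x‖ₑ * ‖contRep v x‖ₑ ∂μ.variation := by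
    refine (μ.enorm_integral_le _).trans ?_
    rw [← lintegral_indicator hSm]
    refine lintegral_mono fun x => ?_
    by_cases hx : x ∈ S
    · have h1 : ‖((1 - χ x : ℝ) : ℂ)‖ₑ ≤ 1 := by
        rw [← ofReal_norm, Complex.norm_real, ← ENNReal.ofReal_one]
        refine ENNReal.ofReal_le_ofReal (abs_le.2 ⟨?_, ?_⟩)
        · linarith [χ.le_one (x := x)]
        · linarith [χ.nonneg (x := x)]
      rw [indicator_of_mem hx, enorm_mul, enorm_mul, RCLike.enorm_conj]
      exact mul_le_of_le_one_left zero_le h1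
    · simp [hχ x hx]
  have h2 := (pow_le_pow_left₀ zero_le hbound 2).trans
    (setLIntegral_contRep_mul_sq_le μ hK u v S)
  have h3 : ∫⁻ x in S, ‖contRep u x‖ₑ ^ 2 ∂μ.variation ≤ ENNReal.ofReal (K * η) := by
    refine (setLIntegral_contRep_sq_variation_le μ u le_rfl _).trans ?_
    rw [ENNReal.ofReal_mul K.coe_nonneg, ENNReal.ofReal_coe_nnreal]
    exact mul_le_mul' hK hSint
  have h4 := h2.trans (mul_le_mul_left h3 _)
  rw [← ofReal_norm, ← ENNReal.ofReal_pow (norm_nonneg _), ← ENNReal.ofReal_mul (by positivity),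
    ENNReal.ofReal_le_ofReal_iff (by positivity)] at h4
  refine (sq_le_sq₀ (norm_nonneg _) (by positivity)).1 (h4.trans ?_)
  have h5 : 2 * (K : ℝ) ^ 2 * η ≤ ε ^ 2 := by
    rw [hη, mul_div_assoc', div_le_iff₀ (by positivity)]
    nlinarith [sq_nonneg ε]
  have := mul_le_mul_of_nonneg_right h5 (sq_nonneg ‖jet v‖)
  linarith

/-- Under vague convergence, integrals of `g v̄` with `g ∈ C_c(ℝ)` converge uniformly for `v` in
bounded subsets of `W_2^1(ℝ)`. -/
lemma LocalMeasure.VagueTendsto.eventually_norm_integral_mul_sub_le {μs : ℕ → ULBMeasure}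
    {μ : ULBMeasure} (h : LocalMeasure.VagueTendsto (fun n => (μs n).1) μ.1) {K : ℝ≥0}
    (hKs : ∀ n, (μs n).1.unifNorm ≤ K) (hK : μ.1.unifNorm ≤ K) {g : ℝ → ℂ} (hg : Continuous g)
    (hgc : HasCompactSupport g) {ε : ℝ} (hε : 0 < ε) :
    ∀ᶠ n in atTop, ∀ v : sobolev, ‖((μs n).1.integral fun x => g x * conj (contRep v x)) -
      μ.1.integral fun x => g x * conj (contRep v x)‖ ≤ ε * ‖jet v‖ := by
  obtain ⟨G, hG⟩ := hg.bounded_above_of_compact_support hgc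
  have hG0 : 0 ≤ G := (norm_nonneg _).trans (hG 0)
  obtain ⟨r, hr⟩ := hgc.isCompact.isBounded.subset_closedBall 0
  obtain ⟨N, hN⟩ := exists_nat_gt r
  have hsub : tsupport g ⊆ Ioc (-N : ℝ) N := fun x hx => by
    have := abs_le.1 (by simpa using hr hx : |x| ≤ r)
    exact ⟨by linarith, by linarith⟩
  set V : ℝ := 2 * N * K with hV
  have hV0 : 0 ≤ V := by positivity
  have hvar : ∀ ν : LocalMeasure, ν.unifNorm ≤ K →
      ν.variation (tsupport g) ≤ ENNReal.ofReal V := fun ν hν => by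
    refine (measure_mono hsub).trans ((ν.variation_Ioc_le N).trans ?_)
    rw [hV, ENNReal.ofReal_mul (by positivity), ENNReal.ofReal_coe_nnreal,
      show (2 * N : ℝ) = ((2 * N : ℕ) : ℝ) by push_cast; ring, ENNReal.ofReal_natCast]
    gcongr
  -- On balls of radius `δ` the function `v` oscillates by at most `√δ * ‖jet v‖`. Against mass `V`
  -- and `|g| ≤ G` this costs `ε / 4` for each of the two measures, leaving `ε / 2` for the finite
  -- sum.
  set δ : ℝ := (ε / (4 * (V * G + 1))) ^ 2 with hδ
  have hδ0 : 0 < δ := by positivity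
  have hδs : V * (G * √δ) ≤ ε / 4 := by
    rw [hδ, Real.sqrt_sq (by positivity), ← mul_assoc, mul_div_assoc', div_le_div_iff₀
      (by positivity) (by positivity)]
    nlinarith
  obtain ⟨t, -, htf, htc⟩ := hgc.isCompact.finite_cover_balls hδ0
  have hfin := htf.fintype
  let pt : Fin (Fintype.card t) → ℝ := fun i => ((Fintype.equivFin t).symm i : ℝ)
  have hcover : tsupport g ⊆ ⋃ i, Metric.ball (pt i) δ := by
    intro x hx
    obtain ⟨y, hy, hxy⟩ := mem_iUnion₂.1 (htc hx)
    exact mem_iUnion.2 ⟨Fintype.equivFin t ⟨y, hy⟩, by simpa [pt] using hxy⟩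
  obtain ⟨ρ, hρs, hρ1, hρ01, hρc⟩ := exists_continuous_sum_one_of_isOpen_isCompact
    (fun i => Metric.isOpen_ball) hgc.isCompact hcover
  have hgρ : ∀ i, Continuous (fun x => g x * (ρ i x : ℂ)) := fun i =>
    hg.mul (Complex.continuous_ofReal.comp (ρ i).continuous)
  have hgρc : ∀ i, HasCompactSupport (fun x => g x * (ρ i x : ℂ)) := fun i => hgc.mul_right
  -- Vague convergence enters only here, through finitely many test functions `g * ρ i` that do not
  -- depend on `v`. The factor `2` is the constant in `norm_contRep_le`.
  have hpart : Tendsto (fun n => ∑ i, 2 * ‖((μs n).1.integral fun x => g x * (ρ i x : ℂ)) -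
      μ.1.integral fun x => g x * (ρ i x : ℂ)‖) atTop (𝓝 0) := by
    have : Tendsto (fun n => ∑ i, 2 * ‖((μs n).1.integral fun x => g x * (ρ i x : ℂ)) -
        μ.1.integral fun x => g x * (ρ i x : ℂ)‖) atTop
        (𝓝 (∑ _i : Fin (Fintype.card t), 2 * ‖(0 : ℂ)‖)) := by
      refine tendsto_finsetSum _ fun i _ => (Tendsto.norm ?_).const_mul 2
      exact tendsto_sub_nhds_zero_iff.2 (h.tendsto_complex (hgρ i) (hgρc i))
    simpa using this
  filter_upwards [hpart.eventually_le_const (half_pos hε)] with n hn v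
  -- The error made when `v̄` is replaced by the interpolation `∑ ρ i * v̄ (pt i)`.
  let R : ℝ → ℂ := fun x => g x * (conj (contRep v x) - ∑ i, (ρ i x : ℂ) * conj (contRep v (pt i)))
  have hRcont : Continuous R := by
    refine hg.mul ((Complex.continuous_conj.comp (continuous_contRep v)).sub ?_)
    exact continuous_finsetSum _ fun i _ =>
      (Complex.continuous_ofReal.comp (ρ i).continuous).mul continuous_const
  have hRc : HasCompactSupport R := hgc.mul_right
  have hdecomp : ∀ ν : ULBMeasure, (ν.1.integral fun x => g x * conj (contRep v x)) =
      ν.1.integral R +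
        ∑ i, conj (contRep v (pt i)) * ν.1.integral fun x => g x * (ρ i x : ℂ) := by
    intro ν
    have hint : ∀ i, Integrable (fun x => conj (contRep v (pt i)) * (g x * (ρ i x : ℂ)))
        ν.1.variation := fun i => (integrable_variation ν (hgρ i) (hgρc i)).const_mul _
    simp only [← LocalMeasure.integral_const_mul]
    rw [← LocalMeasure.integral_finset_sum _ fun i _ => hint i,
      ← LocalMeasure.integral_add (integrable_variation ν hRcont hRc)
        (integrable_finsetSum _ fun i _ => hint i)]
    congr 1
    funext x
    simp only [R, mul_sub, Finset.mul_sum]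
    rw [sub_add, eq_comm, sub_eq_self, sub_eq_zero]
    exact Finset.sum_congr rfl fun i _ => by ring
  have hRle : ∀ x, ‖R x‖ₑ ≤
      (tsupport g).indicator (fun _ => ENNReal.ofReal (G * (√δ * ‖jet v‖))) x := by
    intro x
    by_cases hx : x ∈ tsupport g
    · rw [indicator_of_mem hx, ← ofReal_norm]
      refine ENNReal.ofReal_le_ofReal ?_
      rw [norm_mul]
      refine mul_le_mul (hG x) ?_ (norm_nonneg _) hG0
      have h1 : ∑ i, ρ i x = 1 := by simpa using hρ1 hx
      have h2 : conj (contRep v x) - ∑ i, (ρ i x : ℂ) * conj (contRep v (pt i)) =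
          ∑ i, (ρ i x : ℂ) * conj (contRep v x - contRep v (pt i)) := by
        simp only [map_sub, mul_sub, Finset.sum_sub_distrib, ← Finset.sum_mul]
        rw [← Complex.ofReal_sum, h1, Complex.ofReal_one, one_mul]
      rw [h2]
      calc ‖∑ i, (ρ i x : ℂ) * conj (contRep v x - contRep v (pt i))‖
          ≤ ∑ i, ρ i x * (√δ * ‖jet v‖) := by
            refine norm_sum_le_of_le _ fun i _ => ?_
            rw [norm_mul, Complex.norm_real, Real.norm_of_nonneg (hρ01 i x).1, RCLike.norm_conj]
            by_cases hi : x ∈ tsupport (ρ i)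
            · refine mul_le_mul_of_nonneg_left ?_ (hρ01 i x).1
              exact norm_contRep_sub_le v hδ0.le (Metric.mem_ball.1 (hρs i hi)).le
            · rw [image_eq_zero_of_notMem_tsupport hi, zero_mul, zero_mul]
        _ = √δ * ‖jet v‖ := by rw [← Finset.sum_mul, h1, one_mul]
    · simp [R, image_eq_zero_of_notMem_tsupport hx]
  have hRint : ∀ ν : LocalMeasure, ν.unifNorm ≤ K → ‖ν.integral R‖ ≤ ε / 4 * ‖jet v‖ := by
    intro ν hν
    rw [← ENNReal.ofReal_le_ofReal_iff (by positivity), ofReal_norm]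
    refine (ν.enorm_integral_le _).trans ((lintegral_mono hRle).trans ?_)
    rw [lintegral_indicator_const (isClosed_tsupport g).measurableSet]
    refine (mul_le_mul_right (hvar ν hν) _).trans ?_
    rw [← ENNReal.ofReal_mul (by positivity)]
    refine ENNReal.ofReal_le_ofReal ?_
    have := mul_le_mul_of_nonneg_right hδs (norm_nonneg (jet v))
    linarith
  rw [hdecomp, hdecomp, add_sub_add_comm, ← Finset.sum_sub_distrib]
  have hsum : ‖∑ i, (conj (contRep v (pt i)) * ((μs n).1.integral fun x => g x * (ρ i x : ℂ)) -
      conj (contRep v (pt i)) * μ.1.integral fun x => g x * (ρ i x : ℂ))‖ ≤ ε / 2 * ‖jet v‖ := by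
    refine le_trans ?_ (mul_le_mul_of_nonneg_right hn (norm_nonneg _))
    rw [Finset.sum_mul]
    refine norm_sum_le_of_le _ fun i _ => ?_
    rw [← mul_sub, norm_mul, RCLike.norm_conj, mul_right_comm]
    exact mul_le_mul_of_nonneg_right (norm_contRep_le v _) (norm_nonneg _)
  have h1 := norm_sub_le ((μs n).1.integral R) (μ.1.integral R)
  have h2 := hRint _ (hKs n)
  have h3 := hRint _ hK
  refine (norm_add_le _ _).trans ?_
  linarith

/-- The derivative terms cancel. The rest is cut by `χ` into a compactly supported part, costing `ε
/ 2`, and two tails, costing `ε / 4` each. -/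
lemma eventually_norm_form_sub_le {μs : ℕ → ULBMeasure} {μ : ULBMeasure}
    (h : LocalMeasure.VagueTendsto (fun n => (μs n).1) μ.1) {K : ℝ≥0}
    (hKs : ∀ n, (μs n).1.unifNorm ≤ K) (hK : μ.1.unifNorm ≤ K) (u : sobolev) {ε : ℝ}
    (hε : 0 < ε) :
    ∀ᶠ n in atTop, ∀ v : sobolev, ‖form (μs n) u v - form μ u v‖ ≤ ε * ‖jet v‖ := by
  obtain ⟨χ, hχ, hχc, htail⟩ := exists_cutoff K u (show 0 < ε / 4 by positivity)
  have hg : Continuous fun x => (χ x : ℂ) * contRep u x :=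
    (Complex.continuous_ofReal.comp hχ).mul (continuous_contRep u)
  have hgc : HasCompactSupport fun x => (χ x : ℂ) * contRep u x :=
    (hχc.comp_left (g := fun r : ℝ => (r : ℂ)) Complex.ofReal_zero).mul_right
  filter_upwards [h.eventually_norm_integral_mul_sub_le hKs hK hg hgc (half_pos hε)] with n hn v
  have hsplit : ∀ ν : ULBMeasure, (ν.1.integral fun x => contRep u x * conj (contRep v x)) =
      (ν.1.integral fun x => (χ x : ℂ) * contRep u x * conj (contRep v x)) +
        ν.1.integral fun x => (1 - χ x : ℝ) * (contRep u x * conj (contRep v x)) := by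
    intro ν
    have hi1 : Integrable (fun x => (χ x : ℂ) * contRep u x * conj (contRep v x))
        ν.1.variation :=
      integrable_variation ν (hg.mul (Complex.continuous_conj.comp (continuous_contRep v)))
        hgc.mul_right
    have hi2 : Integrable (fun x => ((1 - χ x : ℝ) : ℂ) * (contRep u x * conj (contRep v x)))
        ν.1.variation := by
      refine ((integrable_contRep_mul ν u v).sub hi1).congr (Eventually.of_forall fun x => ?_)
      simp only [Pi.sub_apply]
      push_cast
      ring
    rw [← LocalMeasure.integral_add hi1 hi2]
    congr 1
    funext x
    push_cast
    ring
  have h1 := htail _ (hKs n) v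
  have h2 := htail _ hK v
  rw [form, form, add_sub_add_left_eq_sub, hsplit, hsplit μ, add_sub_add_comm]
  refine (norm_add_le _ _).trans ?_
  have h3 := norm_sub_le
    ((μs n).1.integral fun x => (1 - χ x : ℝ) * (contRep u x * conj (contRep v x)))
    (μ.1.integral fun x => (1 - χ x : ℝ) * (contRep u x * conj (contRep v x)))
  have h4 := hn v
  linarith

/-- A form version of the second resolvent identity. Coercivity with a constant independent of `n`
turns smallness of `(τ_{μ_n} - τ_μ)(u, ·)` into smallness of the difference of resolvents, even in
the Sobolev norm. -/
lemma tendsto_resolvent {μs : ℕ → ULBMeasure} {μ : ULBMeasure}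
    (h : LocalMeasure.VagueTendsto (fun n => (μs n).1) μ.1) {K : ℝ≥0}
    (hKs : ∀ n, (μs n).1.unifNorm ≤ K) (hK : μ.1.unifNorm ≤ K) {z : ℂ} (hz : z.im ≠ 0)
    {R : ℕ → L2 →L[ℂ] L2} {R₀ : L2 →L[ℂ] L2}
    (hR : ∀ n, IsResolventAt (schrodinger (μs n)) z (R n))
    (hR₀ : IsResolventAt (schrodinger μ) z R₀) (f : L2) :
    Tendsto (fun n => R n f) atTop (𝓝 (R₀ f)) := by
  obtain ⟨c, hc, hcoer⟩ := exists_coercive K hz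
  obtain ⟨u, hu, hform⟩ := hR₀.exists_form_sub_eq_inner f
  rw [Metric.tendsto_nhds]
  intro ε hε
  filter_upwards [eventually_norm_form_sub_le h hKs hK u
    (show 0 < c * (ε / 2) by positivity)] with n hn
  obtain ⟨w, hw, hformw⟩ := (hR n).exists_form_sub_eq_inner f
  set d : sobolev := w + (-1 : ℂ) • u with hd
  have hdL : (d : L2) = (w : L2) - u := by rw [hd]; simp [sub_eq_add_neg]
  -- Both weak equations, tested with `d`, have the same right side, which cancels. What remains
  -- compares the two forms at the fixed `u`.
  have hB : form (μs n) d d - z * inner ℂ (d : L2) (d : L2) =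
      -(form (μs n) u d - form μ u d) := by
    have h1 : form (μs n) d d = form (μs n) w d - form (μs n) u d := by
      conv_lhs => rw [hd, form_add_left, form_smul_left, ← hd]
      ring
    have h2 : inner ℂ (d : L2) (d : L2) =
        inner ℂ (d : L2) (w : L2) - inner ℂ (d : L2) (u : L2) := by
      rw [← inner_sub_right, ← hdL]
    rw [h1, h2]
    linear_combination hformw d - hform d
  have h1 := hcoer _ (hKs n) d
  rw [hB, norm_neg] at h1
  have h2 := h1.trans (hn d)
  have h3 : ‖jet d‖ ≤ ε / 2 := by
    rcases (norm_nonneg (jet d)).eq_or_lt with h0 | h0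
    · rw [← h0]; positivity
    · have : c * (‖jet d‖ * ‖jet d‖) ≤ c * (ε / 2 * ‖jet d‖) := by linarith
      exact le_of_mul_le_mul_right (le_of_mul_le_mul_left this hc) h0
  rw [dist_eq_norm, ← hw, ← hu, ← hdL]
  linarith [norm_coe_le_norm_jet d]

/-- Vague convergence of a bounded sequence of measures implies strong resolvent convergence. -/
theorem strongResolventTendsto_schrodinger {μs : ℕ → ULBMeasure} {μ : ULBMeasure}
    (hbdd : ∃ C : ℝ≥0, ∀ n, (μs n).1.unifNorm ≤ C)
    (hvague : LocalMeasure.VagueTendsto (fun n => (μs n).1) μ.1) :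
    StrongResolventTendsto (fun n => schrodinger (μs n)) (schrodinger μ) := by
  intro z hz
  obtain ⟨C, hC⟩ := hbdd
  have hKs : ∀ n, (μs n).1.unifNorm ≤ ((max C μ.1.unifNorm.toNNReal : ℝ≥0) : ℝ≥0∞) := fun n =>
    (hC n).trans (ENNReal.coe_le_coe.2 (le_max_left _ _))
  have hK : μ.1.unifNorm ≤ ((max C μ.1.unifNorm.toNNReal : ℝ≥0) : ℝ≥0∞) :=
    (ENNReal.coe_toNNReal μ.2.ne).ge.trans (ENNReal.coe_le_coe.2 (le_max_right _ _))
  choose R hR using fun n => exists_resolvent_schrodinger (μs n) hz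
  obtain ⟨R₀, hR₀⟩ := exists_resolvent_schrodinger μ hz
  exact ⟨R, R₀, hR, hR₀, fun f => tendsto_resolvent hvague hKs hK hz hR hR₀ f⟩

end MeasureSchrodinger

theorem mainTheorem8
    (μs : ℕ → MeasureSchrodinger.ULBMeasure) (μ : MeasureSchrodinger.ULBMeasure)
    (hbdd : ∃ C : ℝ≥0, ∀ n, (μs n).1.unifNorm ≤ C)
    (hvague : MeasureSchrodinger.LocalMeasure.VagueTendsto (fun n => (μs n).1) μ.1) :
    (∀ n, IsSelfAdjoint (MeasureSchrodinger.schrodinger (μs n))) ∧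
    IsSelfAdjoint (MeasureSchrodinger.schrodinger μ) ∧
    MeasureSchrodinger.StrongResolventTendsto
      (fun n => MeasureSchrodinger.schrodinger (μs n)) (MeasureSchrodinger.schrodinger μ) :=
  ⟨fun n => MeasureSchrodinger.isSelfAdjoint_schrodinger (μs n),
    MeasureSchrodinger.isSelfAdjoint_schrodinger μ,
    MeasureSchrodinger.strongResolventTendsto_schrodinger hbdd hvague⟩
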